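/- Let $n\ge 2$ and let $M\subset\mathbb{C}^{n+1}$, with coordinates $(z,w)=(z_1,\dots,z_n,w)$, be a $C^\infty$ real submanifold of real dimension $2n$ which near $0$ is defined by an equation $$w=q(z,\bar z)+p(z,\bar z)+iE(z,\bar z),\qquad q(z,\bar z)=\sum_{i=1}^{n}\bigl(|z_i|^2+\lambda_i(z_i^2+\bar z_i^2)\bigr),$$ where $0\le\lambda_1,\dots,\lambda_n<\infty$ and $p,E$ are real-valued $C^\infty$ functions near $0\in\mathbb{C}^n$ that vanish at $0$ to order at least $3$. Suppose that $\lambda_i\ne\frac12$ for some $i$. For a real submanifold $S$ and $x\in S$, let $T^{(1,0)}_xS$ be the space of tangent vectors of type $(1,0)$ of $S$ at $x$. A point $x\in M$ is called a CR point of $M$ if $\dim_{\mathbb{C}}T^{(1,0)}_yM$ is constant for $y\in M$ near $x$. A CR submanifold is a smooth real submanifold $S$ on which $\dim_{\mathbb{C}}T^{(1,0)}_yS$ is constant. A CR point $x$ of $M$ is called non-minimal if $M$ contains a CR submanifold $S\ni x$ with $\dim_{\mathbb{R}}S<\dim_{\mathbb{R}}M$ and $T^{(1,0)}_xS=T^{(1,0)}_xM$.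 Assume that the set of non-minimal CR points of $M$ is an open subset of $M$ whose closure contains $0$. Then for every positive integer $N$ there is a biholomorphic change of coordinates near $0$ of the special form $$z'=z,\qquad w'=w+h(z,w),\qquad h(z,w)=o(|z|^2+|w|)\ \text{ as }(z,w)\to 0$$ (that is, only monomials $z^Iw^j$ with $|I|+2j\ge 3$ occur in $h$), such that in the new coordinates $M$ is defined near $0$ by an equation $w'=\rho(z',\bar z')$, where $\rho$ is a smooth complex-valued function near $0$ and $\operatorname{Im}\rho$ vanishes at $0$ to order at least $N$. -/

import Mathlib

open scoped ContDiff Topology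
open Filter Asymptotics

noncomputable section

/-- The space `ℂⁿ⁺¹` with coordinates `(z, w)`, `z ∈ ℂⁿ`, `w ∈ ℂ`. (The sup norm carried by this
type is equivalent to the Euclidean one, so smoothness and orders of vanishing are unaffected.) -/
abbrev CSpace (n : ℕ) : Type := (Fin n → ℂ) × ℂ

/-- `S` is an embedded `C^∞` real submanifold of `ℂⁿ⁺¹` of real dimension `k`: near each of its
points there is a smooth diffeomorphism between open sets of `ℂⁿ⁺¹` that straightens `S` to a
`k`-dimensional real linear subspace. -/
def IsSmoothSubmanifold {n : ℕ} (k : ℕ) (S : Set (CSpace n)) : Prop :=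
  ∀ x ∈ S, ∃ (e : OpenPartialHomeomorph (CSpace n) (CSpace n)) (P : Submodule ℝ (CSpace n)),
    x ∈ e.source ∧ ContDiffOn ℝ ∞ e e.source ∧ ContDiffOn ℝ ∞ e.symm e.target ∧
    Module.finrank ℝ P = k ∧ ∀ y ∈ e.source, (y ∈ S ↔ e y ∈ P)

/-- `v` is the velocity at `x` of a curve lying in `S`. -/
def IsVelocity {n : ℕ} (S : Set (CSpace n)) (x v : CSpace n) : Prop :=
  ∃ γ : ℝ → CSpace n, γ 0 = x ∧ (∀ᶠ t in 𝓝 (0 : ℝ), γ t ∈ S) ∧ HasDerivAt γ v 0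

/-- The real tangent space `T_x S`. (For a submanifold the velocities already form a linear
subspace.) -/
def realTangent {n : ℕ} (S : Set (CSpace n)) (x : CSpace n) : Submodule ℝ (CSpace n) :=
  Submodule.span ℝ {v | IsVelocity S x v}

/-- The space `T^{(1,0)}_x S` of tangent vectors of type `(1,0)`. The vector
`∑ aⱼ ∂/∂zⱼ + b ∂/∂w` is identified with `v = (a, b) ∈ ℂⁿ⁺¹`; it equals `(v - i J v) / 2` for
the complex structure `J`, so it lies in `ℂ ⊗ T_x S` if and only if `v` and `J v = i v` both
belong to `T_x S`. -/
def tangentOneZero {n : ℕ} (S : Set (CSpace n)) (x : CSpace n) : Submodule ℂ (CSpace n) where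
  carrier := {v | v ∈ realTangent S x ∧ Complex.I • v ∈ realTangent S x}
  zero_mem' := by simp
  add_mem' := by
    rintro a b ⟨ha, ha'⟩ ⟨hb, hb'⟩
    refine ⟨add_mem ha hb, ?_⟩
    rw [smul_add]
    exact add_mem ha' hb'
  smul_mem' := by
    rintro c v ⟨hv, hv'⟩
    have key : ∀ d : ℂ, d • v ∈ realTangent S x := by
      intro d
      have h : d • v = d.re • v + d.im • (Complex.I • v) := by
        conv_lhs => rw [← Complex.re_add_im d]
        rw [add_smul, mul_smul, Complex.coe_smul, Complex.coe_smul]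
      rw [h]
      exact add_mem (Submodule.smul_mem _ _ hv) (Submodule.smul_mem _ _ hv')
    refine ⟨key c, ?_⟩
    rw [smul_smul]
    exact key _

/-- The CR dimension `CR_S(x) = dim_ℂ T^{(1,0)}_x S`. -/
def crDim {n : ℕ} (S : Set (CSpace n)) (x : CSpace n) : ℕ :=
  Module.finrank ℂ (tangentOneZero S x)

/-- `x` is a CR point of `M`: the CR dimension is constant on `M` near `x`. -/
def IsCRPoint {n : ℕ} (M : Set (CSpace n)) (x : CSpace n) : Prop :=
  x ∈ M ∧ ∀ᶠ y in 𝓝[M] x, crDim M y = crDim M x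

/-- `S` is a CR submanifold of real dimension `k`. -/
def IsCRSubmanifold {n : ℕ} (k : ℕ) (S : Set (CSpace n)) : Prop :=
  IsSmoothSubmanifold k S ∧ ∃ d : ℕ, ∀ x ∈ S, crDim S x = d

/-- `x` is a non-minimal CR point of the `m`-dimensional submanifold `M`: it is a CR point, and
`M` contains a CR submanifold `S` through `x`, of dimension smaller than that of `M`, with
`T^{(1,0)}_x S = T^{(1,0)}_x M`. -/
def IsNonminimalCRPoint {n : ℕ} (m : ℕ) (M : Set (CSpace n)) (x : CSpace n) : Prop :=
  IsCRPoint M x ∧ ∃ (S : Set (CSpace n)) (k : ℕ), S ⊆ M ∧ x ∈ S ∧ k < m ∧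
    IsCRSubmanifold k S ∧ tangentOneZero S x = tangentOneZero M x

/-- `f` is of class `C^∞` (as a function of real variables) in a neighborhood of `0 ∈ ℂⁿ`. -/
def SmoothNearZero {n : ℕ} {F : Type*} [NormedAddCommGroup F] [NormedSpace ℝ F]
    (f : (Fin n → ℂ) → F) : Prop :=
  ∃ U : Set (Fin n → ℂ), IsOpen U ∧ (0 : Fin n → ℂ) ∈ U ∧ ContDiffOn ℝ ∞ f U

/-- `f` vanishes at the origin to order at least `k`, i.e. `f = O(|z|^k)`. -/
def VanishesToOrder {n : ℕ} {F : Type*} [NormedAddCommGroup F]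
    (k : ℕ) (f : (Fin n → ℂ) → F) : Prop :=
  f =O[𝓝 0] fun z => ‖z‖ ^ k

/-- `M` is defined near `0 ∈ ℂⁿ⁺¹` by the equation `w = ρ(z, z̄)`. -/
def IsGraphNearZero {n : ℕ} (M : Set (CSpace n)) (ρ : (Fin n → ℂ) → ℂ) : Prop :=
  ∀ᶠ x : CSpace n in 𝓝 0, (x ∈ M ↔ x.2 = ρ x.1)

/-- The quadric `q(z, z̄) = ∑ (|zᵢ|² + λᵢ (zᵢ² + z̄ᵢ²))`, as a real number: `zᵢ² + z̄ᵢ²` is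
`2 Re (zᵢ²)`. -/
def bishopQuadric {n : ℕ} (lam : Fin n → ℝ) (z : Fin n → ℂ) : ℝ :=
  ∑ i, (‖z i‖ ^ 2 + lam i * (2 * (z i ^ 2).re))

/-- `Φ` is a biholomorphic change of coordinates near `0` of the special form
`(z, w) ↦ (z, w + h(z, w))` with `h(z, w) = o(|z|² + |w|)`, i.e. `h` contains only monomials
`z^I w^j` with `|I| + 2 j ≥ 3`. -/
structure IsSpecialTransform {n : ℕ} (Φ : OpenPartialHomeomorph (CSpace n) (CSpace n)) : Prop where
  zero_mem : (0 : CSpace n) ∈ Φ.source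
  holomorphic : DifferentiableOn ℂ Φ Φ.source
  holomorphic_symm : DifferentiableOn ℂ Φ.symm Φ.target
  special : ∃ h : CSpace n → ℂ, (∀ x ∈ Φ.source, Φ x = (x.1, x.2 + h x)) ∧
    h =o[𝓝 0] fun x => (∑ i, ‖x.1 i‖ ^ 2) + ‖x.2‖

end

/-!
# Flattening a non-minimal codimension-two submanifold at a complex point to finite order

Over the `z`-space `M` is the graph `w = F(z)`, `F = q + O(|z|³)`. A function on `M` is a function
of `z`, and the tangential fields of type `(1,0)` and `(0,1)` are the `X = ∑ Xᵢ ∂ᵢ` with `X F̄ = 0`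
and the `Y = ∑ Yᵢ ∂̄ᵢ` with `Y F = 0`. Replacing `F` by `G = F + h(z, F)` with `h` holomorphic does
not change these fields, since `∂̄G` is a multiple of `∂̄F`.

*Non-minimality.* At a non-minimal point the functions vanishing on the CR submanifold `S` are stable
under the tangential fields (`hasStableFunctions_of_nonminimal`), hence under their brackets, and
one of them, `ψ`, has nonzero differential there. As the tangential fields annihilate `ψ`, at that
point `∂ψ = α ∂Ḡ` and `∂̄ψ = β ∂̄G`. Evaluating `[X, Y] ψ = 0` and `[Z, [X, Y]] ψ = 0` gives linear
relations between `α` and `β` whose coefficients are the mixed Hessians of `G` and `Ḡ` and third-order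
expressions in them (`bracket_relations`). As `(α, β) ≠ 0`, the `2 × 2` determinants of coefficients
vanish (`levi_proportional`). They vanish on an open set adherent to the origin, hence to infinite
order at the origin.

*Linearization.* If `G - Ḡ` has leading part `e`, homogeneous of degree `m ≥ 3`, the leading terms of
the determinants are linear in `e`: the Hessians and third-order expressions of `e` in the tangential
directions of the model `q` are proportional to those of `q`. The proportionality factor is a priori
a quotient by the Levi form `q_a q_ā + q_b q_b̄`. For `λ_a ≠ 1/2` this polynomial is prime, and the
third-order condition makes it divide the numerator (`leviPoly_dvd_hessRot`). So the factor is a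
polynomial `κ`, and the conditions become the system `IsFlatSol`: up to a multiple of `∂q ⊗ ∂̄q`, the
mixed Hessian of `e` is `κ` times that of `q` plus `∂κ ⊗ ∂̄q + ∂q ⊗ ∂̄κ`.

*Solving the system.* Compatibility of third derivatives shows that `κ` solves the same system
(`IsFlatSol.multiplier`). Its degree is `m - 2`, so by induction, integrating in `q`,
`e = ∑ (cⱼ(z) + dⱼ(z̄)) qʲ` (`IsFlatSol.exists_decomposition`). As `e` is purely imaginary, it is
removed by adding to `G` the weighted homogeneous `-½ ∑ (cⱼ - d̄ⱼ)(z) Fʲ` (`exists_correction`).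
Iterating up to order `N` and inverting `(z, w) ↦ (z, w + h(z, w))` gives the theorem.
-/

namespace Flattening

open MvPolynomial

variable {n : ℕ}

/-! ### The ring of smooth functions and its Wirtinger derivatives -/

/-- The `ℂ`-algebra of globally defined smooth functions `ℂⁿ → ℂ`, smooth in the real sense. -/
def SmoothFn (n : ℕ) : Subalgebra ℂ ((Fin n → ℂ) → ℂ) where
  carrier := {f | ContDiff ℝ ∞ f}
  mul_mem' {f _} hf hg := ContDiff.mul (show ContDiff ℝ ∞ f from hf) hg
  add_mem' {f _} hf hg := ContDiff.add (show ContDiff ℝ ∞ f from hf) hg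
  algebraMap_mem' c := show ContDiff ℝ ∞ (fun _ : Fin n → ℂ => c) from contDiff_const

namespace SmoothFn

instance : CoeFun (SmoothFn n) (fun _ => (Fin n → ℂ) → ℂ) := ⟨fun f => f.1⟩

lemma contDiff (f : SmoothFn n) : ContDiff ℝ ∞ f := f.2

lemma differentiable (f : SmoothFn n) : Differentiable ℝ f :=
  (contDiff f).differentiable (by simp)

lemma continuous (f : SmoothFn n) : Continuous f := (contDiff f).continuous

@[ext] lemma ext {f g : SmoothFn n} (h : ∀ z, f z = g z) : f = g := Subtype.ext (funext h)

@[simp] lemma add_apply (f g : SmoothFn n) (z) : (f + g) z = f z + g z := rfl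
@[simp] lemma sub_apply (f g : SmoothFn n) (z) : (f - g) z = f z - g z := rfl
@[simp] lemma neg_apply (f : SmoothFn n) (z) : (-f) z = -f z := rfl
@[simp] lemma mul_apply (f g : SmoothFn n) (z) : (f * g) z = f z * g z := rfl
@[simp] lemma zero_apply (z) : (0 : SmoothFn n) z = 0 := rfl
@[simp] lemma smul_apply (c : ℂ) (f : SmoothFn n) (z) : (c • f) z = c * f z := rfl

/-- Evaluation at a point as an algebra homomorphism. -/
def evalAt (z : Fin n → ℂ) : SmoothFn n →ₐ[ℂ] ℂ :=
  (Pi.evalAlgHom ℂ (fun _ : Fin n → ℂ => ℂ) z).comp (SmoothFn n).val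

@[simp] lemma evalAt_apply (z : Fin n → ℂ) (f : SmoothFn n) : evalAt z f = f z := rfl

@[simp] lemma sum_apply {ι : Type*} (s : Finset ι) (f : ι → SmoothFn n) (z) :
    (∑ i ∈ s, f i) z = ∑ i ∈ s, f i z := map_sum (evalAt z) f s

@[simp] lemma pow_apply (f : SmoothFn n) (k : ℕ) (z) : (f ^ k) z = f z ^ k :=
  map_pow (evalAt z) f k

@[simp] lemma algebraMap_apply (c : ℂ) (z) : algebraMap ℂ (SmoothFn n) c z = c := rfl

/-- The directional derivative along a real direction `v`, as a `ℂ`-linear derivation. -/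
noncomputable def dirDeriv (v : Fin n → ℂ) : Derivation ℂ (SmoothFn n) (SmoothFn n) :=
  Derivation.mk'
    { toFun := fun f => ⟨fun z => fderiv ℝ f z v,
        ((contDiff f).fderiv_right (m := ∞) (by simp)).clm_apply contDiff_const⟩
      map_add' := fun f g => by
        ext z
        change fderiv ℝ (fun z => f z + g z) z v = fderiv ℝ f z v + fderiv ℝ g z v
        rw [fderiv_fun_add (differentiable f z) (differentiable g z)]; rfl
      map_smul' := fun c f => by
        ext z
        change fderiv ℝ (fun z => c * f z) z v = c * fderiv ℝ f z v
        rw [fderiv_const_mul (differentiable f z)]; rfl }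
    (fun f g => by
      ext z
      change fderiv ℝ (fun z => f z * g z) z v = f z * fderiv ℝ g z v + g z * fderiv ℝ f z v
      rw [fderiv_fun_mul (differentiable f z) (differentiable g z)]; rfl)

lemma dirDeriv_apply (v : Fin n → ℂ) (f : SmoothFn n) (z) :
    dirDeriv v f z = fderiv ℝ f z v := rfl

lemma dirDeriv_comm (v w : Fin n → ℂ) (f : SmoothFn n) :
    dirDeriv v (dirDeriv w f) = dirDeriv w (dirDeriv v f) := by
  ext z
  have hd : DifferentiableAt ℝ (fderiv ℝ f) z :=
    ((contDiff f).fderiv_right (m := ∞) (by simp)).differentiable (by simp) z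
  have key : ∀ a b : Fin n → ℂ,
      fderiv ℝ (fun y => fderiv ℝ f y a) z b = fderiv ℝ (fderiv ℝ f) z b a := by
    intro a b
    rw [fderiv_clm_apply hd (differentiableAt_const a)]
    simp
  have hs : IsSymmSndFDerivAt ℝ f z := (contDiff f).contDiffAt.isSymmSndFDerivAt (by
    rw [minSmoothness_of_isRCLikeNormedField]; exact WithTop.coe_le_coe.2 le_top)
  change fderiv ℝ (fun y => fderiv ℝ f y w) z v = fderiv ℝ (fun y => fderiv ℝ f y v) z w
  rw [key, key, hs.eq]

/-- Complex conjugation of smooth functions. -/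
noncomputable def conj : SmoothFn n →+* SmoothFn n where
  toFun f := ⟨fun z => starRingEnd ℂ (f z), Complex.conjCLE.contDiff.comp (contDiff f)⟩
  map_one' := by ext; simp
  map_mul' _ _ := by ext; simp
  map_zero' := by ext; simp
  map_add' _ _ := by ext; simp

@[simp] lemma conj_apply (f : SmoothFn n) (z) : conj f z = starRingEnd ℂ (f z) := rfl

@[simp] lemma conj_conj (f : SmoothFn n) : conj (conj f) = f := by ext; simp

@[simp] lemma conj_smul (c : ℂ) (f : SmoothFn n) :
    conj (c • f) = starRingEnd ℂ c • conj f := by ext; simp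

lemma conj_dirDeriv (v : Fin n → ℂ) (f : SmoothFn n) :
    conj (dirDeriv v f) = dirDeriv v (conj f) := by
  ext z
  have h := (Complex.conjCLE.toContinuousLinearMap.hasFDerivAt.comp z
    (differentiable f z).hasFDerivAt).fderiv
  change starRingEnd ℂ (fderiv ℝ f z v) = fderiv ℝ (Complex.conjCLE ∘ f) z v
  rw [show (Complex.conjCLE ∘ f : (Fin n → ℂ) → ℂ) =
    (Complex.conjCLE.toContinuousLinearMap ∘ f) from rfl, h]
  rfl

/-- The Wirtinger derivatives: `wirt (inl i)` is `∂/∂zᵢ` and `wirt (inr i)` is `∂/∂z̄ᵢ`. -/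
noncomputable def wirt : Fin n ⊕ Fin n → Derivation ℂ (SmoothFn n) (SmoothFn n)
  | Sum.inl i => (1 / 2 : ℂ) • (dirDeriv (Pi.single i 1) - Complex.I • dirDeriv (Pi.single i Complex.I))
  | Sum.inr i => (1 / 2 : ℂ) • (dirDeriv (Pi.single i 1) + Complex.I • dirDeriv (Pi.single i Complex.I))

lemma wirt_comm (a b : Fin n ⊕ Fin n) (f : SmoothFn n) :
    wirt a (wirt b f) = wirt b (wirt a f) := by
  have h := fun v w : Fin n → ℂ => dirDeriv_comm v w f
  rcases a with i | i <;> rcases b with j | j <;>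
  · simp only [wirt, Derivation.smul_apply, Derivation.sub_apply, Derivation.add_apply,
      Derivation.map_smul, map_sub, map_add]
    rw [h (Pi.single i 1) (Pi.single j 1), h (Pi.single i 1) (Pi.single j Complex.I),
      h (Pi.single i Complex.I) (Pi.single j 1),
      h (Pi.single i Complex.I) (Pi.single j Complex.I)]
    module

lemma conj_wirt (a : Fin n ⊕ Fin n) (f : SmoothFn n) :
    conj (wirt a f) = wirt a.swap (conj f) := by
  have h2 : starRingEnd ℂ 2 = 2 := Complex.conj_ofNat 2
  rcases a with i | i <;> simp [wirt, conj_dirDeriv, sub_eq_add_neg, h2]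

lemma dirDeriv_eq_wirt (v : Fin n → ℂ) (f : SmoothFn n) (z) :
    dirDeriv v f z = ∑ i, (v i * wirt (Sum.inl i) f z + starRingEnd ℂ (v i) * wirt (Sum.inr i) f z) := by
  have hv : v = ∑ i, ((v i).re • (Pi.single i 1 : Fin n → ℂ)
      + (v i).im • (Pi.single i Complex.I : Fin n → ℂ)) := by
    ext j
    simp [Finset.sum_apply, Pi.single_apply, Finset.sum_add_distrib]
  rw [dirDeriv_apply]
  conv_lhs => rw [hv]
  rw [map_sum]
  refine Finset.sum_congr rfl fun i _ => ?_
  rw [map_add, map_smul, map_smul]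
  simp only [wirt, Derivation.smul_apply, Derivation.sub_apply, Derivation.add_apply, smul_apply,
    sub_apply, add_apply, dirDeriv_apply, Complex.real_smul]
  obtain ⟨x, y⟩ := v i
  have h1 : (⟨x, y⟩ : ℂ) = x + y * Complex.I := Complex.mk_eq_add_mul_I x y
  have h2 : starRingEnd ℂ (⟨x, y⟩ : ℂ) = x - y * Complex.I := by
    rw [h1]; simp [sub_eq_add_neg]
  rw [h2, h1]
  have h3 : ((x : ℂ) + y * Complex.I).re = x := by simp
  have h4 : ((x : ℂ) + y * Complex.I).im = y := by simp
  rw [h3, h4]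
  linear_combination ((y:ℂ) * (fderiv ℝ f z (Pi.single i Complex.I))) * Complex.I_sq

/-- The coordinate functions `zᵢ` and `z̄ᵢ`. -/
noncomputable def coord : Fin n ⊕ Fin n → SmoothFn n
  | Sum.inl i => ⟨fun z => z i, show ContDiff ℝ ∞ (fun z : Fin n → ℂ => z i) from contDiff_apply ℝ ℂ i⟩
  | Sum.inr i => conj ⟨fun z => z i, show ContDiff ℝ ∞ (fun z : Fin n → ℂ => z i) from contDiff_apply ℝ ℂ i⟩

@[simp] lemma coord_inl (i : Fin n) (z) : coord (Sum.inl i) z = z i := rfl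
@[simp] lemma coord_inr (i : Fin n) (z) : coord (Sum.inr i) z = starRingEnd ℂ (z i) := rfl

lemma conj_coord (a : Fin n ⊕ Fin n) : conj (coord a) = coord a.swap := by
  rcases a with i | i <;> ext z <;> simp

lemma wirt_coord (a b : Fin n ⊕ Fin n) : wirt a (coord b) = if a = b then 1 else 0 := by
  have h1 : ∀ (i : Fin n) (v : Fin n → ℂ) (z), dirDeriv v (coord (Sum.inl i)) z = v i := by
    intro i v z
    change fderiv ℝ (fun z : Fin n → ℂ => z i) z v = v i
    rw [fderiv_apply differentiableAt_id]; simp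
  have h2 : ∀ (i : Fin n) (v : Fin n → ℂ) (z),
      dirDeriv v (coord (Sum.inr i)) z = starRingEnd ℂ (v i) := by
    intro i v z
    rw [← Sum.swap_inl, ← conj_coord, ← conj_dirDeriv, conj_apply, h1]
  have hI := Complex.I_mul_I
  rcases a with i | i <;> rcases b with j | j <;> ext z <;> by_cases hij : j = i <;>
    simp [wirt, h1, h2, hij, eq_comm (a := i) (b := j)] <;> norm_num

/-- A polynomial in the variables `zᵢ` (`inl i`) and `z̄ᵢ` (`inr i`), seen as a smooth function. -/
noncomputable def ev : MvPolynomial (Fin n ⊕ Fin n) ℂ →ₐ[ℂ] SmoothFn n := aeval coord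

@[simp] lemma ev_X (a : Fin n ⊕ Fin n) : ev (X a) = coord a := by simp [ev]

lemma ev_C (c : ℂ) : ev (C c) = algebraMap ℂ (SmoothFn n) c := by simp [ev]

lemma wirt_ev (a : Fin n ⊕ Fin n) (p : MvPolynomial (Fin n ⊕ Fin n) ℂ) :
    wirt a (ev p) = ev (pderiv a p) := by
  classical
  induction p using MvPolynomial.induction_on with
  | C c => simp
  | add p q hp hq => simp [hp, hq]
  | mul_X p b hp =>
    rw [map_mul, Derivation.leibniz, Derivation.leibniz, hp, map_add, ev_X, wirt_coord, pderiv_X]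
    simp only [smul_eq_mul, map_mul, ev_X, Pi.single_apply]
    by_cases h : a = b
    · subst h; simp
    · simp [h, Ne.symm h]

end SmoothFn

/-! ### Orders of vanishing and leading parts -/

namespace SmoothFn

/-- All Wirtinger derivatives of `f` of order less than `k` vanish at the origin. -/
def VanishOrd : ℕ → SmoothFn n → Prop
  | 0, _ => True
  | k + 1, f => f 0 = 0 ∧ ∀ a, VanishOrd k (wirt a f)

namespace VanishOrd

lemma zero (k : ℕ) : VanishOrd k (0 : SmoothFn n) := by
  induction k with
  | zero => trivial
  | succ k ih => exact ⟨rfl, fun a => by rwa [map_zero]⟩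

lemma add {k : ℕ} {f g : SmoothFn n} (hf : VanishOrd k f) (hg : VanishOrd k g) :
    VanishOrd k (f + g) := by
  induction k generalizing f g with
  | zero => trivial
  | succ k ih =>
    refine ⟨by simp [hf.1, hg.1], fun a => ?_⟩
    rw [map_add]
    exact ih (hf.2 a) (hg.2 a)

lemma mono {k l : ℕ} (hkl : k ≤ l) {f : SmoothFn n} (hf : VanishOrd l f) : VanishOrd k f := by
  induction k generalizing l f with
  | zero => trivial
  | succ k ih =>
    obtain ⟨l, rfl⟩ : ∃ l', l = l' + 1 := ⟨l - 1, by omega⟩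
    exact ⟨hf.1, fun a => ih (by omega) (hf.2 a)⟩

lemma wirt {k : ℕ} {f : SmoothFn n} (hf : VanishOrd k f) (a) :
    VanishOrd (k - 1) (SmoothFn.wirt a f) := by
  cases k with
  | zero => trivial
  | succ k => exact hf.2 a

lemma mul {k l s : ℕ} (hs : s ≤ k + l) {f g : SmoothFn n} (hf : VanishOrd k f)
    (hg : VanishOrd l g) : VanishOrd s (f * g) := by
  induction s generalizing k l f g with
  | zero => trivial
  | succ s ih =>
    refine ⟨?_, fun a => ?_⟩
    · rcases k with _ | k
      · obtain ⟨l, rfl⟩ : ∃ l', l = l' + 1 := ⟨l - 1, by omega⟩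
        simp [hg.1]
      · simp [hf.1]
    · rw [Derivation.leibniz]
      exact add (ih (by omega) hf (hg.wirt a)) (ih (by omega) hg (hf.wirt a))

lemma mul_left {k : ℕ} (f : SmoothFn n) {g : SmoothFn n} (hg : VanishOrd k g) :
    VanishOrd k (f * g) := mul (k := 0) (by omega) trivial hg

lemma smul {k : ℕ} (c : ℂ) {g : SmoothFn n} (hg : VanishOrd k g) : VanishOrd k (c • g) := by
  rw [Algebra.smul_def]; exact mul_left _ hg

lemma neg {k : ℕ} {g : SmoothFn n} (hg : VanishOrd k g) : VanishOrd k (-g) := by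
  simpa using hg.smul (-1)

lemma sub {k : ℕ} {f g : SmoothFn n} (hf : VanishOrd k f) (hg : VanishOrd k g) :
    VanishOrd k (f - g) := by
  rw [sub_eq_add_neg]; exact hf.add hg.neg

lemma sum {ι : Type*} (s : Finset ι) {k : ℕ} {f : ι → SmoothFn n}
    (hf : ∀ i ∈ s, VanishOrd k (f i)) : VanishOrd k (∑ i ∈ s, f i) := by
  classical
  induction s using Finset.induction_on with
  | empty => simpa using zero k
  | insert i s hi ih =>
    rw [Finset.sum_insert hi]
    exact (hf i (by simp)).add (ih fun j hj => hf j (by simp [hj]))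

lemma conj {k : ℕ} {f : SmoothFn n} (hf : VanishOrd k f) : VanishOrd k (SmoothFn.conj f) := by
  induction k generalizing f with
  | zero => trivial
  | succ k ih =>
    refine ⟨by simp [hf.1], fun a => ?_⟩
    rw [← a.swap_swap, ← conj_wirt]
    exact ih (hf.2 _)

lemma ev {k : ℕ} {p : MvPolynomial (Fin n ⊕ Fin n) ℂ} (hp : p.IsHomogeneous k) :
    VanishOrd k (SmoothFn.ev p) := by
  induction k generalizing p with
  | zero => trivial
  | succ k ih =>
    refine ⟨?_, fun a => ?_⟩
    · have h0 : ∀ a, coord (n := n) a 0 = 0 := by rintro (i | i) <;> simp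
      have : evalAt (n := n) 0 (SmoothFn.ev p) = constantCoeff p := by
        rw [SmoothFn.ev, ← AlgHom.comp_apply, comp_aeval]
        simp only [evalAt_apply, h0]
        exact aeval_zero' p
      rw [← evalAt_apply, this, constantCoeff_eq]
      exact hp.coeff_eq_zero (by simp)
    · rw [wirt_ev]
      exact ih (by simpa using hp.pderiv)

/-- A homogeneous polynomial in `z, z̄` of degree `k` that vanishes to order `k + 1` is zero. -/
lemma poly_eq_zero {k : ℕ} {p : MvPolynomial (Fin n ⊕ Fin n) ℂ} (hp : p.IsHomogeneous k)
    (h : VanishOrd (k + 1) (SmoothFn.ev p)) : p = 0 := by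
  induction k generalizing p with
  | zero =>
    rw [← totalDegree_zero_iff_isHomogeneous, totalDegree_eq_zero_iff_eq_C] at hp
    have := h.1
    rw [hp, ev_C, algebraMap_apply] at this
    rw [hp, this, C_0]
  | succ k ih =>
    have hz : ∀ a, pderiv a p = 0 := fun a =>
      ih (by simpa using hp.pderiv) (by rw [← wirt_ev]; exact h.2 a)
    have he := hp.sum_X_mul_pderiv
    simp only [hz, mul_zero, Finset.sum_const_zero] at he
    rw [eq_comm, nsmul_eq_mul, mul_eq_zero] at he
    exact he.resolve_left (Nat.cast_ne_zero.2 k.succ_ne_zero)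

end VanishOrd

/-- The homogeneous polynomial `p` of degree `k` in `z, z̄` is the leading part of `f` at the
origin: `f = p + O(|z|^{k+1})`. -/
structure Lead (k : ℕ) (f : SmoothFn n) (p : MvPolynomial (Fin n ⊕ Fin n) ℂ) : Prop where
  hom : p.IsHomogeneous k
  rem : VanishOrd (k + 1) (f - ev p)

namespace Lead

variable {k l : ℕ} {f g : SmoothFn n} {p q : MvPolynomial (Fin n ⊕ Fin n) ℂ}

lemma vanishOrd (h : Lead k f p) : VanishOrd k f := by
  simpa using (h.rem.mono k.le_succ).add (VanishOrd.ev h.hom)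

lemma add (hf : Lead k f p) (hg : Lead k g q) : Lead k (f + g) (p + q) :=
  ⟨hf.hom.add hg.hom, by
    have := hf.rem.add hg.rem
    rwa [show f + g - ev (p + q) = f - ev p + (g - ev q) by rw [map_add]; ring]⟩

lemma neg (hf : Lead k f p) : Lead k (-f) (-p) :=
  ⟨hf.hom.neg, by
    have := hf.rem.neg
    rwa [show -f - ev (-p) = -(f - ev p) by rw [map_neg]; ring]⟩

lemma sub (hf : Lead k f p) (hg : Lead k g q) : Lead k (f - g) (p - q) := by
  rw [sub_eq_add_neg, sub_eq_add_neg]; exact hf.add hg.neg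

lemma zero (k : ℕ) : Lead k (0 : SmoothFn n) 0 :=
  ⟨isHomogeneous_zero _ _ _, by simpa using VanishOrd.zero _⟩

lemma sum {ι : Type*} (s : Finset ι) {f : ι → SmoothFn n}
    {p : ι → MvPolynomial (Fin n ⊕ Fin n) ℂ} (h : ∀ i ∈ s, Lead k (f i) (p i)) :
    Lead k (∑ i ∈ s, f i) (∑ i ∈ s, p i) :=
  ⟨IsHomogeneous.sum _ _ _ fun i hi => (h i hi).hom, by
    rw [map_sum, ← Finset.sum_sub_distrib]
    exact VanishOrd.sum _ fun i hi => (h i hi).rem⟩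

lemma mul (hf : Lead k f p) (hg : Lead l g q) : Lead (k + l) (f * g) (p * q) :=
  ⟨hf.hom.mul hg.hom, by
    have h1 := VanishOrd.mul (s := k + l + 1) (by omega) hf.rem hg.vanishOrd
    have h2 := VanishOrd.mul (s := k + l + 1) (by omega) (VanishOrd.ev hf.hom) hg.rem
    rw [show f * g - ev (p * q) = (f - ev p) * g + ev p * (g - ev q) by rw [map_mul]; ring]
    exact h1.add h2⟩

lemma wirt (hf : Lead (k + 1) f p) (a) : Lead k (SmoothFn.wirt a f) (pderiv a p) :=
  ⟨by simpa using hf.hom.pderiv, by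
    have := hf.rem.2 a
    rwa [map_sub, wirt_ev] at this⟩

lemma eq_zero (hf : Lead k f p) (h : VanishOrd (k + 1) f) : p = 0 :=
  VanishOrd.poly_eq_zero hf.hom (by simpa using h.sub hf.rem)

lemma ev (hp : p.IsHomogeneous k) : Lead k (SmoothFn.ev p) p :=
  ⟨hp, by simpa using VanishOrd.zero _⟩

lemma of_sub (hf : Lead k f p) (h : VanishOrd (k + 1) (g - f)) : Lead k g p :=
  ⟨hf.hom, by simpa using h.add hf.rem⟩

end Lead

/-- A smooth function vanishing to order `k` has a leading part of degree `k`. It is recovered from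
the leading parts of the first derivatives by Euler's identity. -/
lemma VanishOrd.exists_lead {k : ℕ} {f : SmoothFn n} (hf : VanishOrd k f) : ∃ p, Lead k f p := by
  induction k generalizing f with
  | zero =>
    exact ⟨C (f 0), isHomogeneous_C _ _, by simp [sub_apply, algebraMap_apply],
      fun _ => trivial⟩
  | succ k ih =>
    choose p hp using fun a => ih (hf.2 a)
    have hcomm : ∀ a b, pderiv a (p b) = pderiv b (p a) := by
      intro a b
      rcases k with _ | k
      · have h0 : ∀ a b, pderiv a (p b) = 0 := by
          intro a b
          have := (hp b).hom
          rw [← totalDegree_zero_iff_isHomogeneous, totalDegree_eq_zero_iff_eq_C] at this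
          rw [this, pderiv_C]
        rw [h0, h0]
      · have h := ((hp b).wirt a).sub ((hp a).wirt b)
        rw [wirt_comm, sub_self] at h
        exact sub_eq_zero.1 (h.eq_zero (VanishOrd.zero _))
    have hk : ((k : ℂ) + 1) ≠ 0 := by exact_mod_cast k.succ_ne_zero
    set P : MvPolynomial (Fin n ⊕ Fin n) ℂ := C (((k : ℂ) + 1)⁻¹) * ∑ b, X b * p b with hP
    have hPhom : P.IsHomogeneous (k + 1) := by
      refine IsHomogeneous.C_mul ?_ _
      refine IsHomogeneous.sum _ _ _ fun b _ => ?_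
      rw [add_comm]
      exact (isHomogeneous_X _ _).mul (hp b).hom
    have hPd : ∀ a, pderiv a P = p a := by
      classical
      intro a
      rw [hP, pderiv_C_mul, map_sum]
      simp only [pderiv_mul, pderiv_X, Pi.single_apply, hcomm a, Finset.sum_add_distrib]
      rw [(hp a).hom.sum_X_mul_pderiv]
      simp only [eq_comm (b := a), ite_mul, one_mul, zero_mul, Finset.sum_ite_eq,
        Finset.mem_univ, if_true]
      rw [show p a + k • p a = C ((k : ℂ) + 1) * p a by
        simp only [map_add, map_natCast, map_one, nsmul_eq_mul]; ring, ← mul_assoc, ← C_mul,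
        inv_mul_cancel₀ hk, C_1, one_mul]
    refine ⟨P, hPhom, ?_, fun a => ?_⟩
    · simp [hf.1, (VanishOrd.ev hPhom).1]
    · rw [map_sub, wirt_ev, hPd]
      exact (hp a).rem

lemma norm_fderiv_le (f : SmoothFn n) (z : Fin n → ℂ) :
    ‖fderiv ℝ f z‖ ≤ ∑ i, (‖wirt (Sum.inl i) f z‖ + ‖wirt (Sum.inr i) f z‖) := by
  refine ContinuousLinearMap.opNorm_le_bound _ (by positivity) fun v => ?_
  rw [← dirDeriv_apply, dirDeriv_eq_wirt, Finset.sum_mul]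
  refine (norm_sum_le _ _).trans (Finset.sum_le_sum fun i _ => (norm_add_le _ _).trans ?_)
  have := norm_le_pi_norm v i
  rw [norm_mul, norm_mul, RCLike.norm_conj, add_mul, mul_comm, mul_comm ‖v i‖]
  gcongr

lemma VanishOrd.isBigO {k : ℕ} {f : SmoothFn n} (hf : VanishOrd k f) :
    (f : (Fin n → ℂ) → ℂ) =O[𝓝 0] fun z => ‖z‖ ^ k := by
  induction k generalizing f with
  | zero =>
    simp only [pow_zero]
    exact (SmoothFn.continuous f).continuousAt.norm.isBoundedUnder_le.isBigO_one ℝ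
  | succ k ih =>
    have hd : (fun z => fderiv ℝ f z) =O[𝓝 0] fun z => ‖z‖ ^ k := by
      have h1 : (fun z => ∑ i, (‖SmoothFn.wirt (Sum.inl i) f z‖
          + ‖SmoothFn.wirt (Sum.inr i) f z‖)) =O[𝓝 0] fun z => ‖z‖ ^ k :=
        IsBigO.fun_sum fun i _ => ((ih (hf.2 _)).norm_left).add ((ih (hf.2 _)).norm_left)
      refine IsBigO.trans (IsBigO.of_bound 1 (Eventually.of_forall fun z => ?_)) h1
      rw [one_mul]
      exact (norm_fderiv_le f z).trans (le_abs_self _)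
    obtain ⟨c, hc, hcb⟩ := hd.exists_pos
    rw [IsBigOWith, Metric.eventually_nhds_iff_ball] at hcb
    obtain ⟨r, hr, hb⟩ := hcb
    refine IsBigO.of_bound c (Metric.eventually_nhds_iff_ball.2 ⟨r, hr, fun z hz => ?_⟩)
    have hz' : ‖z‖ < r := by simpa using hz
    have := (convex_closedBall (0 : Fin n → ℂ) ‖z‖).norm_image_sub_le_of_norm_fderiv_le
      (𝕜 := ℝ) (f := f) (C := c * ‖z‖ ^ k) (x := 0) (y := z)
      (fun y _ => SmoothFn.differentiable f y) (fun y hy => ?_) (by simp) (by simp)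
    · rw [hf.1, sub_zero, sub_zero] at this
      rw [norm_pow, norm_norm, pow_succ, ← mul_assoc]
      exact this
    · have hy' : ‖y‖ ≤ ‖z‖ := by simpa using hy
      refine (hb y (by simpa using hy'.trans_lt hz')).trans ?_
      rw [norm_pow, norm_norm]
      gcongr

lemma ev_real_smul {k : ℕ} {p : MvPolynomial (Fin n ⊕ Fin n) ℂ} (hp : p.IsHomogeneous k) (t : ℝ)
    (z : Fin n → ℂ) : ev p (t • z) = (t : ℂ) ^ k * ev p z := by
  have h : ∀ z : Fin n → ℂ, ev p z = eval (fun a => coord a z) p := by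
    intro z
    rw [← evalAt_apply, ev, ← AlgHom.comp_apply, comp_aeval, aeval_def]
    rfl
  have hc : ∀ a, coord a (t • z) = t * coord a z := by rintro (i | i) <;> simp
  rw [h, h, eval_eq, eval_eq, Finset.mul_sum]
  refine Finset.sum_congr rfl fun d hd => ?_
  simp only [hc, mul_pow, Finset.prod_mul_distrib, Finset.prod_pow_eq_pow_sum]
  rw [← hp.degree_eq_sum_deg_support hd]
  ring

lemma VanishOrd.of_isBigO {k : ℕ} {f : SmoothFn n}
    (hf : (f : (Fin n → ℂ) → ℂ) =O[𝓝 0] fun z => ‖z‖ ^ k) : VanishOrd k f := by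
  suffices h : ∀ j ≤ k, VanishOrd j f from h k le_rfl
  intro j
  induction j with
  | zero => exact fun _ => trivial
  | succ j ih =>
    intro hj
    obtain ⟨p, hp⟩ := (ih (by omega)).exists_lead
    have hO : (SmoothFn.ev p : (Fin n → ℂ) → ℂ) =O[𝓝 0] fun z => ‖z‖ ^ (j + 1) := by
      have h1 : (f : (Fin n → ℂ) → ℂ) =O[𝓝 0] fun z => ‖z‖ ^ (j + 1) :=
        hf.trans <| IsBigO.of_bound 1 <| by
          filter_upwards [Metric.ball_mem_nhds (0 : Fin n → ℂ) one_pos] with z hz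
          rw [norm_pow, norm_pow, norm_norm, one_mul]
          exact pow_le_pow_of_le_one (norm_nonneg z) (mem_ball_zero_iff.1 hz).le hj
      have h2 := h1.sub hp.rem.isBigO
      refine h2.congr_left fun z => ?_
      simp
    have h0 : ∀ z, SmoothFn.ev p z = 0 := by
      intro z
      obtain ⟨c, hc⟩ := hO.bound
      have ht : Tendsto (fun t : ℝ => t • z) (𝓝[>] 0) (𝓝 0) := by
        have : Tendsto (fun t : ℝ => t • z) (𝓝 0) (𝓝 ((0 : ℝ) • z)) :=
          (continuous_id.smul continuous_const).tendsto 0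
        rw [zero_smul] at this
        exact this.mono_left nhdsWithin_le_nhds
      have hlim : Tendsto (fun t : ℝ => t * (c * ‖z‖ ^ (j + 1))) (𝓝[>] 0) (𝓝 0) := by
        have : Tendsto (fun t : ℝ => t * (c * ‖z‖ ^ (j + 1))) (𝓝 0)
            (𝓝 (0 * (c * ‖z‖ ^ (j + 1)))) := (continuous_id.mul continuous_const).tendsto 0
        rw [zero_mul] at this
        exact this.mono_left nhdsWithin_le_nhds
      have hle : ‖SmoothFn.ev p z‖ ≤ 0 := by
        refine ge_of_tendsto hlim ?_
        filter_upwards [ht.eventually hc, self_mem_nhdsWithin] with t h1 h2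
        have h2 : 0 < t := h2
        rw [ev_real_smul hp.hom, norm_mul, norm_pow, norm_pow, norm_norm, norm_smul,
          Complex.norm_real, Real.norm_of_nonneg h2.le, mul_pow, pow_succ t] at h1
        have h3 : 0 < t ^ j := pow_pos h2 j
        refine le_of_mul_le_mul_left ?_ h3
        linarith
      exact norm_le_zero_iff.1 hle
    have : SmoothFn.ev p = 0 := by ext z; exact h0 z
    have h := hp.rem
    rwa [this, sub_zero] at h

/-- A smooth function that vanishes on an open set adherent to the origin is flat there. -/
lemma VanishOrd.of_eqOn_open {O : Set (Fin n → ℂ)} (hO : IsOpen O) (h0 : 0 ∈ closure O)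
    {f : SmoothFn n} (hf : ∀ z ∈ O, f z = 0) (k : ℕ) : VanishOrd k f := by
  induction k generalizing f with
  | zero => trivial
  | succ k ih =>
    refine ⟨?_, fun a => ih fun z hz => ?_⟩
    · have : closure O ⊆ {z | f z = 0} :=
        closure_minimal hf (isClosed_eq (SmoothFn.continuous f) continuous_const)
      exact this h0
    · have hd : fderiv ℝ f z = 0 := by
        have : (f : (Fin n → ℂ) → ℂ) =ᶠ[𝓝 z] fun _ => 0 := by
          filter_upwards [hO.mem_nhds hz] with y hy using hf y hy
        rw [this.fderiv_eq]; simp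
      rcases a with i | i <;>
        simp [SmoothFn.wirt, dirDeriv_apply, hd]

end SmoothFn

/-! ### Mixed Hessians and tangential vector fields -/

section Abstract

variable {A : Type*} [CommRing A]

/-- The coefficients of the vector field `u_k ∂_l - u_l ∂_k`, which annihilates every function with
gradient `u`. -/
def rot (u : Fin n → A) (k l : Fin n) : Fin n → A :=
  fun j => (if j = l then u k else 0) - (if j = k then u l else 0)

lemma sum_rot_mul (u : Fin n → A) (k l : Fin n) (v : Fin n → A) :
    ∑ j, rot u k l j * v j = u k * v l - u l * v k := by
  simp [rot, sub_mul, Finset.sum_sub_distrib]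

/-- Every vector proportional to `u` over the fraction field is a multiple of `u`. -/
def IsUnimodularLike (u : Fin n → A) : Prop :=
  ∀ v : Fin n → A, (∀ k l, v l * u k = v k * u l) → ∃ s, ∀ l, v l = s * u l

lemma isUnimodularLike_of_prime [IsDomain A] {u : Fin n → A} (hn : 2 ≤ n) (hu : ∀ i, Prime (u i))
    (hnd : ∀ i k, i ≠ k → ¬ u i ∣ u k) : IsUnimodularLike u := by
  intro v hv
  have hdvd : ∀ i, u i ∣ v i := by
    intro i
    have : Nontrivial (Fin n) := Fin.nontrivial_iff_two_le.2 hn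
    obtain ⟨k, hk⟩ := exists_ne i
    refine ((hu i).dvd_or_dvd (b := u k) ?_).resolve_right (hnd i k hk.symm)
    exact ⟨v k, by rw [hv k i]; ring⟩
  choose s hs using hdvd
  have i0 : Fin n := ⟨0, by omega⟩
  refine ⟨s i0, fun l => ?_⟩
  have h := hv i0 l
  rw [hs l, hs i0] at h
  have h0 : u l * u i0 * (s l - s i0) = 0 := by linear_combination h
  have := (mul_eq_zero.1 h0).resolve_left (mul_ne_zero (hu l).ne_zero (hu i0).ne_zero)
  rw [hs l, sub_eq_zero.1 this, mul_comm]

/-- A family `Ψ i j` that is proportional to `u` in `i` and to `u'` in `j` is a multiple of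
`u i * u' j`. -/
lemma exists_rank_one [IsDomain A] {u u' : Fin n → A} {i0 : Fin n} (hi0 : u i0 ≠ 0)
    (hu : IsUnimodularLike u) (hu' : IsUnimodularLike u') {Ψ : Fin n → Fin n → A}
    (h1 : ∀ k l j, Ψ l j * u k = Ψ k j * u l) (h2 : ∀ i k l, Ψ i l * u' k = Ψ i k * u' l) :
    ∃ s, ∀ i j, Ψ i j = s * (u i * u' j) := by
  choose s hs using fun j => hu (fun i => Ψ i j) fun k l => h1 k l j
  obtain ⟨t, ht⟩ := hu' s fun k l => by
    have := h2 i0 k l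
    rw [hs, hs] at this
    exact mul_left_cancel₀ hi0 (by linear_combination this)
  exact ⟨t, fun i j => by rw [hs, ht]; ring⟩

variable [Algebra ℂ A]

/-- The mixed Hessian `∑ Xᵢ Yⱼ ∂ᵢ ∂'ⱼ f`. -/
def hess (d d' : Fin n → Derivation ℂ A A) (f : A) (X Y : Fin n → A) : A :=
  ∑ i, ∑ j, X i * Y j * d i (d' j f)

/-- The vector field `∑ Xᵢ ∂ᵢ`, acting as a derivation. -/
def along (d : Fin n → Derivation ℂ A A) (X : Fin n → A) : Derivation ℂ A A :=
  ∑ i, X i • d i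

/-- The third-order expression `Z (f(X, Y)) + f(Z, X(Y))`, where `f(X, Y)` is the mixed Hessian and
`X(Y)` is obtained by differentiating the coefficients of `Y` along `X`. Up to sign it is what
`∂' f` takes on the iterated bracket `[Z, [X, Y]]`, when `X, Z` are of type `(1,0)`, `Y` is of type
`(0,1)`, and `Y` annihilates `f`. -/
def third (d d' : Fin n → Derivation ℂ A A) (f : A) (X Y Z : Fin n → A) : A :=
  along d Z (hess d d' f X Y) + hess d d' f Z (fun j => along d X (Y j))

lemma along_apply (d : Fin n → Derivation ℂ A A) (X : Fin n → A) (f : A) :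
    along d X f = ∑ i, X i * d i f := by
  rw [along]
  induction (Finset.univ : Finset (Fin n)) using Finset.induction_on with
  | empty => simp
  | insert a s ha ih => rw [Finset.sum_insert ha, Finset.sum_insert ha, Derivation.add_apply, ih]; rfl

lemma along_rot (d : Fin n → Derivation ℂ A A) (u : Fin n → A) (k l : Fin n) (f : A) :
    along d (rot u k l) f = u k * d l f - u l * d k f := by
  rw [along_apply, sum_rot_mul]

lemma hess_eq (d d' : Fin n → Derivation ℂ A A) (f : A) (X Y : Fin n → A) :
    hess d d' f X Y = ∑ i, X i * ∑ j, Y j * d i (d' j f) := by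
  simp only [hess, Finset.mul_sum, mul_assoc]

lemma hess_rot (d d' : Fin n → Derivation ℂ A A) (f : A) (u u' : Fin n → A) (k l k' l' : Fin n) :
    hess d d' f (rot u k l) (rot u' k' l') =
      u k * (u' k' * d l (d' l' f) - u' l' * d l (d' k' f))
        - u l * (u' k' * d k (d' l' f) - u' l' * d k (d' k' f)) := by
  rw [hess_eq]
  simp only [sum_rot_mul]

lemma hess_swap {d d' : Fin n → Derivation ℂ A A} (hd : ∀ i j f, d i (d' j f) = d' j (d i f))
    (f : A) (X Y : Fin n → A) : hess d' d f Y X = hess d d' f X Y := by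
  rw [hess, hess, Finset.sum_comm]
  refine Finset.sum_congr rfl fun i _ => Finset.sum_congr rfl fun j _ => ?_
  rw [hd]; ring

/-- `E` solves the linearized flattening system for `q` with multipliers `κ` and `κ'`. The model
solution is `E = c(z) qʲ⁺¹` with `κ = (j + 1) c qʲ`, `κ' = (j + 1) j c qʲ⁻¹`. -/
def IsFlatSol (d d' : Fin n → Derivation ℂ A A) (q E κ κ' : A) : Prop :=
  ∀ i j, d i (d' j E) = (if i = j then κ else 0) + d i κ * d' j q + d i q * d' j κ
    - κ' * (d i q * d' j q)

/-- The first multiplier of a solution is itself a solution: this is the compatibility condition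
`∂ₖ∂ᵢ = ∂ᵢ∂ₖ` for the second derivatives of `E`. -/
lemma IsFlatSol.multiplier [IsDomain A] {d d' : Fin n → Derivation ℂ A A} {q E κ κ' : A}
    {i0 : Fin n} (hi0 : d i0 q ≠ 0)
    (hdd : ∀ i j f, d i (d j f) = d j (d i f)) (hdd' : ∀ i j f, d i (d' j f) = d' j (d i f))
    (hd'd' : ∀ i j f, d' i (d' j f) = d' j (d' i f))
    (hq : ∀ i j, d i (d' j q) = if i = j then 1 else 0)
    (hu : IsUnimodularLike fun i => d i q) (hu' : IsUnimodularLike fun i => d' i q)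
    (h : IsFlatSol d d' q E κ κ') : ∃ κ'', IsFlatSol d d' q κ κ' κ'' := by
  have hq' : ∀ i j, d' j (d i q) = if i = j then 1 else 0 := fun i j => by rw [← hdd', hq]
  have hite : ∀ (D : Derivation ℂ A A) (i j : Fin n),
      D (if i = j then κ else 0) = (if i = j then 1 else 0) * D κ := by
    intro D i j; split_ifs <;> simp
  have e1 : ∀ k l j, (d l (d' j κ) - (if l = j then 1 else 0) * κ' - d l κ' * d' j q) * d k q
      = (d k (d' j κ) - (if k = j then 1 else 0) * κ' - d k κ' * d' j q) * d l q := by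
    intro k l j
    have h1 := congrArg (d k) (h l j)
    have h2 := congrArg (d l) (h k j)
    rw [hdd, h2] at h1
    simp only [map_add, map_sub, Derivation.leibniz, smul_eq_mul, hite, hq, hdd l k κ, hdd l k q]
      at h1
    linear_combination h1
  have e2 : ∀ i k l, (d i (d' l κ) - (if i = l then 1 else 0) * κ' - d i q * d' l κ') * d' k q
      = (d i (d' k κ) - (if i = k then 1 else 0) * κ' - d i q * d' k κ') * d' l q := by
    intro i k l
    have h1 := congrArg (d' k) (h i l)
    have h2 := congrArg (d' l) (h i k)
    rw [← hdd', hd'd', hdd', h2] at h1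
    simp only [map_add, map_sub, Derivation.leibniz, smul_eq_mul, hite, hq', hd'd' l k κ,
      hd'd' l k q, ← hdd'] at h1
    linear_combination h1
  choose s hs using fun j => hu _ fun k l => e1 k l j
  choose t ht using fun i => hu' _ fun k l => e2 i k l
  obtain ⟨c, hc⟩ := hu' (fun j => d' j κ' - s j) fun k l => by
    refine mul_left_cancel₀ hi0 ?_
    linear_combination d' l q * (ht i0 k - hs k i0) - d' k q * (ht i0 l - hs l i0)
  refine ⟨c, fun i j => ?_⟩
  have h1 := hs j i
  have h2 := hc j
  have h3 : (if i = j then κ' else 0) = (if i = j then 1 else 0) * κ' := by split_ifs <;> simp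
  rw [h3]
  linear_combination h1 - d i q * h2

/-- Along `u_k ∂_l - u_l ∂_k`, the second- and third-order bracket conditions determine the mixed
Hessian of `E` up to the term that defines `κ'`. -/
lemma remainder_proportional [IsDomain A] {d d' : Fin n → Derivation ℂ A A} {q E κ : A}
    {a b : Fin n} (hab : a ≠ b)
    (hq : ∀ i j, d i (d' j q) = if i = j then 1 else 0)
    (hP : d a q * d' a q + d b q * d' b q ≠ 0)
    (h1 : ∀ k l k' l', hess d d' E (rot (d · q) k l) (rot (d' · q) k' l')
      = κ * hess d d' q (rot (d · q) k l) (rot (d' · q) k' l'))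
    (h2 : ∀ k l, third d d' E (rot (d · q) a b) (rot (d' · q) a b) (rot (d · q) k l)
      = κ * third d d' q (rot (d · q) a b) (rot (d' · q) a b) (rot (d · q) k l))
    (k l j : Fin n) :
    (d l (d' j E) - (if l = j then κ else 0) - d l κ * d' j q - d l q * d' j κ) * d k q
      = (d k (d' j E) - (if k = j then κ else 0) - d k κ * d' j q - d k q * d' j κ) * d l q := by
  have hκ : ∀ i j : Fin n, (if i = j then κ else 0) = (if i = j then 1 else 0) * κ := by
    intro i j; split_ifs <;> simp
  simp only [hκ]
  set w : Fin n → A := fun j =>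
    d k q * (d l (d' j E) - (if l = j then 1 else 0) * κ - d l κ * d' j q - d l q * d' j κ)
    - d l q * (d k (d' j E) - (if k = j then 1 else 0) * κ - d k κ * d' j q - d k q * d' j κ)
    with hw
  have w1 : ∀ k' l', d' k' q * w l' = d' l' q * w k' := by
    intro k' l'
    have := h1 k l k' l'
    simp only [hess_rot, hq] at this
    simp only [hw]
    linear_combination this
  have w2 : d a q * w a + d b q * w b = 0 := by
    have h := h2 k l
    rw [third, third, h1, Derivation.leibniz] at h
    have ht : (fun j => along d (rot (d · q) a b) (rot (d' · q) a b j)) =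
        fun j => (if j = a then -d a q else 0) + (if j = b then -d b q else 0) := by
      ext j
      rw [rot, map_sub]
      by_cases hja : j = a
      · subst hja
        simp [along_rot, hq, hab]
      · by_cases hjb : j = b
        · subst hjb
          simp [along_rot, hq, hab.symm]
        · simp [hja, hjb]
    have hs : ∀ v : Fin n → A, ∑ j, ((if j = a then -d a q else 0) + (if j = b then -d b q else 0))
        * v j = -(d a q * v a + d b q * v b) := by
      intro v
      simp [add_mul, Finset.sum_add_distrib]; ring
    simp only [ht] at h
    simp only [hess_eq, hs, sum_rot_mul, hq, along_rot, smul_eq_mul, hab, hab.symm, if_true,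
      if_false] at h
    simp only [hw]
    linear_combination -h
  have hwj : w j = 0 := by
    refine (mul_eq_zero.1 (?_ : (d a q * d' a q + d b q * d' b q) * w j = 0)).resolve_left hP
    linear_combination d' j q * w2 + d a q * w1 a j + d b q * w1 b j
  simp only [hw] at hwj
  linear_combination hwj

end Abstract

/-! ### Solutions of the linearized system -/

section FlatSol

variable {A : Type*} [CommRing A] [Algebra ℂ A] {d d' : Fin n → Derivation ℂ A A} {q : A}

lemma IsFlatSol.add {E₁ E₂ κ₁ κ₂ κ₁' κ₂' : A} (h₁ : IsFlatSol d d' q E₁ κ₁ κ₁')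
    (h₂ : IsFlatSol d d' q E₂ κ₂ κ₂') : IsFlatSol d d' q (E₁ + E₂) (κ₁ + κ₂) (κ₁' + κ₂') := by
  intro i j
  have e₁ := h₁ i j
  have e₂ := h₂ i j
  simp only [map_add]
  split_ifs at e₁ e₂ ⊢ <;> linear_combination e₁ + e₂

lemma IsFlatSol.smul {E κ κ' : A} (c : ℂ) (h : IsFlatSol d d' q E κ κ') :
    IsFlatSol d d' q (c • E) (c • κ) (c • κ') := by
  intro i j
  have e := h i j
  simp only [Derivation.map_smul, e]
  simp only [Algebra.smul_def]
  split_ifs <;> ring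

lemma IsFlatSol.sub {E₁ E₂ κ₁ κ₂ κ₁' κ₂' : A} (h₁ : IsFlatSol d d' q E₁ κ₁ κ₁')
    (h₂ : IsFlatSol d d' q E₂ κ₂ κ₂') : IsFlatSol d d' q (E₁ - E₂) (κ₁ - κ₂) (κ₁' - κ₂') := by
  have := h₁.add (h₂.smul (-1))
  simpa [sub_eq_add_neg] using this

lemma IsFlatSol.sum {ι : Type*} (s : Finset ι) {E κ κ' : ι → A}
    (h : ∀ i ∈ s, IsFlatSol d d' q (E i) (κ i) (κ' i)) :
    IsFlatSol d d' q (∑ i ∈ s, E i) (∑ i ∈ s, κ i) (∑ i ∈ s, κ' i) := by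
  classical
  induction s using Finset.induction_on with
  | empty => intro i j; simp
  | insert a s ha ih =>
    rw [Finset.sum_insert ha, Finset.sum_insert ha, Finset.sum_insert ha]
    exact (h a (by simp)).add (ih fun i hi => h i (by simp [hi]))

/-- Functions `c qᵏ⁺¹` with `c` holomorphic solve the system. -/
lemma isFlatSol_left (hq : ∀ i j, d i (d' j q) = if i = j then 1 else 0) {c : A}
    (hc : ∀ j, d' j c = 0) (k : ℕ) :
    IsFlatSol d d' q (c * q ^ (k + 1)) ((k + 1) * (c * q ^ k))
      ((k + 1) * (k * (c * q ^ (k - 1)))) := by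
  intro i j
  simp only [Derivation.leibniz, Derivation.leibniz_pow, hc, map_add, hq, smul_eq_mul, nsmul_eq_mul,
    Derivation.map_natCast, Derivation.map_one_eq_zero, mul_zero, add_zero,
    Nat.add_sub_cancel, Nat.cast_add, Nat.cast_one]
  split_ifs <;> ring

lemma isFlatSol_right (hdd' : ∀ i j f, d i (d' j f) = d' j (d i f))
    (hq : ∀ i j, d i (d' j q) = if i = j then 1 else 0) {c : A}
    (hc : ∀ j, d j c = 0) (k : ℕ) :
    IsFlatSol d d' q (c * q ^ (k + 1)) ((k + 1) * (c * q ^ k))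
      ((k + 1) * (k * (c * q ^ (k - 1)))) := by
  intro i j
  have hq' : ∀ i j, d' j (d i q) = if i = j then 1 else 0 := fun i j => by rw [← hdd', hq]
  rw [hdd']
  simp only [Derivation.leibniz, Derivation.leibniz_pow, hc, map_add, hq', smul_eq_mul,
    nsmul_eq_mul,
    Derivation.map_natCast, Derivation.map_one_eq_zero, mul_zero, add_zero,
    Nat.add_sub_cancel, Nat.cast_add, Nat.cast_one]
  split_ifs <;> ring

end FlatSol

/-! ### The model quadric as a polynomial -/

/-- Polynomials in `z` (variables `inl i`) and `z̄` (variables `inr i`). -/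
abbrev Poly (n : ℕ) : Type := MvPolynomial (Fin n ⊕ Fin n) ℂ

/-- The formal `∂/∂zᵢ`. -/
noncomputable abbrev dz (i : Fin n) : Derivation ℂ (Poly n) (Poly n) := pderiv (Sum.inl i)

/-- The formal `∂/∂z̄ᵢ`. -/
noncomputable abbrev dzb (i : Fin n) : Derivation ℂ (Poly n) (Poly n) := pderiv (Sum.inr i)

lemma pderiv_comm {σ R : Type*} [CommRing R] (a b : σ) (p : MvPolynomial σ R) :
    pderiv a (pderiv b p) = pderiv b (pderiv a p) := by
  classical
  have h : ⁅(pderiv a : Derivation R (MvPolynomial σ R) (MvPolynomial σ R)),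
      (pderiv b : Derivation R (MvPolynomial σ R) (MvPolynomial σ R))⁆ = 0 := by
    refine derivation_ext fun c => ?_
    rw [Derivation.commutator_apply, pderiv_X, pderiv_X]
    simp only [Pi.single_apply]
    split_ifs <;> simp
  have := congrArg (fun D : Derivation R (MvPolynomial σ R) (MvPolynomial σ R) => D p) h
  simpa [Derivation.commutator_apply, sub_eq_zero] using this

/-- The quadric `q = ∑ (zᵢ z̄ᵢ + λᵢ (zᵢ² + z̄ᵢ²))` as a polynomial. -/
noncomputable def quad (lam : Fin n → ℝ) : Poly n :=
  ∑ i, (X (Sum.inl i) * X (Sum.inr i) + C (lam i : ℂ) * (X (Sum.inl i) ^ 2 + X (Sum.inr i) ^ 2))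

section Quad

variable (lam : Fin n → ℝ)

lemma two_mul_C {σ : Type*} (c : ℂ) : 2 * C c = (C (2 * c) : MvPolynomial σ ℂ) := by
  rw [C_mul, map_ofNat]

lemma quad_isHomogeneous : (quad lam).IsHomogeneous 2 := by
  refine IsHomogeneous.sum _ _ _ fun i _ => ?_
  refine IsHomogeneous.add ((isHomogeneous_X ℂ (Sum.inl i : Fin n ⊕ Fin n)).mul
    (isHomogeneous_X ℂ (Sum.inr i))) (IsHomogeneous.C_mul ?_ _)
  exact (isHomogeneous_X_pow _ 2).add (isHomogeneous_X_pow _ 2)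

lemma dz_quad (i : Fin n) :
    dz i (quad lam) = X (Sum.inr i) + 2 * C (lam i : ℂ) * X (Sum.inl i) := by
  classical
  rw [quad, map_sum, Finset.sum_eq_single i]
  · simp [pderiv_X, Derivation.leibniz_pow]
    ring
  · intro j _ hj
    simp [pderiv_X, Derivation.leibniz_pow, hj]
  · simp

lemma dzb_quad (i : Fin n) :
    dzb i (quad lam) = X (Sum.inl i) + 2 * C (lam i : ℂ) * X (Sum.inr i) := by
  classical
  rw [quad, map_sum, Finset.sum_eq_single i]
  · simp [pderiv_X, Derivation.leibniz_pow]
    ring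
  · intro j _ hj
    simp [pderiv_X, Derivation.leibniz_pow, hj]
  · simp

lemma dz_dzb_quad (i j : Fin n) : dz i (dzb j (quad lam)) = if i = j then 1 else 0 := by
  classical
  rw [dzb_quad, two_mul_C, map_add, pderiv_C_mul]
  simp [pderiv_X, Pi.single_apply, eq_comm]

lemma dz_dz_quad (i j : Fin n) :
    dz i (dz j (quad lam)) = if i = j then 2 * C (lam i : ℂ) else 0 := by
  classical
  rw [dz_quad, two_mul_C, map_add, pderiv_C_mul, pderiv_X, pderiv_X, ← two_mul_C]
  by_cases h : i = j
  · subst h; simp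
  · simp [h, Ne.symm h]

lemma notMem_vars_linear {σ : Type*} {x y y' : σ} (h : x ≠ y) (h' : x ≠ y') (c : ℂ) :
    x ∉ (X y + C c * X y' : MvPolynomial σ ℂ).vars := by
  classical
  intro hx
  rcases Finset.mem_union.1 (vars_add_subset _ _ hx) with hx | hx
  · exact h (by simpa [vars_X] using hx)
  · rcases Finset.mem_union.1 (vars_mul _ _ hx) with hx | hx
    · simp at hx
    · exact h' (by simpa [vars_X] using hx)

lemma prime_linear {σ : Type*} {x y : σ} (h : x ≠ y) (c : ℂ) :
    Prime (X x + C c * X y : MvPolynomial σ ℂ) := by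
  classical
  have := irreducible_mul_X_add (1 : MvPolynomial σ ℂ) (C c * X y) x one_ne_zero (by simp)
    (fun hx => ?_) isRelPrime_one_left
  · rw [one_mul] at this
    exact this.prime
  · have := vars_mul _ _ hx
    simp [vars_C, vars_X] at this
    exact h this

lemma isUnimodularLike_dz (hn : 2 ≤ n) : IsUnimodularLike fun i => dz i (quad lam) := by
  refine isUnimodularLike_of_prime hn (fun i => ?_) fun i k hik hdvd => ?_
  · rw [dz_quad, two_mul_C]; exact prime_linear (by simp) _
  · rw [dz_quad, dz_quad] at hdvd
    have := map_dvd (aeval (fun x => if x = Sum.inr k then (1 : ℂ) else 0)) hdvd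
    simp [hik] at this

lemma isUnimodularLike_dzb (hn : 2 ≤ n) : IsUnimodularLike fun i => dzb i (quad lam) := by
  refine isUnimodularLike_of_prime hn (fun i => ?_) fun i k hik hdvd => ?_
  · rw [dzb_quad, two_mul_C]; exact prime_linear (by simp) _
  · rw [dzb_quad, dzb_quad] at hdvd
    have := map_dvd (aeval (fun x => if x = Sum.inl k then (1 : ℂ) else 0)) hdvd
    simp [hik] at this

/-- The Levi form `q_a q_ā + q_b q_b̄` of the model in the direction of `q_a ∂_b - q_b ∂_a`. -/
noncomputable def leviPoly (a b : Fin n) : Poly n :=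
  dz a (quad lam) * dzb a (quad lam) + dz b (quad lam) * dzb b (quad lam)

variable {lam}

/-- For `λ_a ≠ 1/2` the forms `q_a` and `q_ā` are independent and can be taken as coordinates; the
Levi form then has degree one in `q_a`. -/
lemma leviPoly_prime {a b : Fin n} (hab : a ≠ b) (hlam : ∀ i, 0 ≤ lam i) (ha : lam a ≠ 1 / 2) :
    Prime (leviPoly lam a b) := by
  classical
  have hc : (1 - 4 * (lam a : ℂ) ^ 2) ≠ 0 := by
    have h1 : (1 - 4 * lam a ^ 2) ≠ 0 := by
      intro h
      have h2 : (1 - 2 * lam a) * (1 + 2 * lam a) = 0 := by linear_combination h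
      rcases mul_eq_zero.1 h2 with h3 | h3
      · exact ha (by linarith)
      · linarith [hlam a]
    exact_mod_cast h1
  set c : ℂ := (1 - 4 * (lam a : ℂ) ^ 2)⁻¹ with hcdef
  let f : Poly n →ₐ[ℂ] Poly n := aeval fun x =>
    if x = Sum.inl a then dzb a (quad lam) else if x = Sum.inr a then dz a (quad lam) else X x
  let g : Poly n →ₐ[ℂ] Poly n := aeval fun x =>
    if x = Sum.inl a then C c * (X (Sum.inl a) - 2 * C (lam a : ℂ) * X (Sum.inr a))
    else if x = Sum.inr a then C c * (X (Sum.inr a) - 2 * C (lam a : ℂ) * X (Sum.inl a)) else X x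
  have hcC : C c * (1 - 4 * C (lam a : ℂ) ^ 2) = (1 : Poly n) := by
    rw [← C_pow, show (4 : Poly n) = C 4 from (map_ofNat C 4).symm, ← C_mul, ← C_1, ← C_sub, ← C_mul,
      inv_mul_cancel₀ hc]
  have hC2 : (C 2 : Poly n) = 2 := map_ofNat C 2
  have hfg : f.comp g = AlgHom.id ℂ _ := by
    refine algHom_ext fun x => ?_
    by_cases h1 : x = Sum.inl a
    · subst h1
      simp [f, g, dz_quad, dzb_quad, two_mul_C]
      simp only [hC2]
      linear_combination X (Sum.inl a) * hcC
    · by_cases h2 : x = Sum.inr a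
      · subst h2
        simp [f, g, dz_quad, dzb_quad, two_mul_C]
        simp only [hC2]
        linear_combination X (Sum.inr a) * hcC
      · simp [f, g, h1, h2]
  have hgf : g.comp f = AlgHom.id ℂ _ := by
    refine algHom_ext fun x => ?_
    by_cases h1 : x = Sum.inl a
    · subst h1
      simp [f, g, dz_quad, dzb_quad, two_mul_C]
      simp only [hC2]
      linear_combination X (Sum.inl a) * hcC
    · by_cases h2 : x = Sum.inr a
      · subst h2
        simp [f, g, dz_quad, dzb_quad, two_mul_C]
        simp only [hC2]
        linear_combination X (Sum.inr a) * hcC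
      · simp [f, g, h1, h2]
  let e : Poly n ≃ₐ[ℂ] Poly n := AlgEquiv.ofAlgHom f g hfg hgf
  have he : leviPoly lam a b
      = e (X (Sum.inl a) * X (Sum.inr a) + dz b (quad lam) * dzb b (quad lam)) := by
    have hf : ∀ p, e p = f p := fun p => rfl
    have h1 : f (dz b (quad lam)) = dz b (quad lam) := by
      rw [dz_quad, two_mul_C]; simp [f, hab.symm]
    have h2 : f (dzb b (quad lam)) = dzb b (quad lam) := by
      rw [dzb_quad, two_mul_C]; simp [f, hab.symm]
    rw [hf, map_add, map_mul, map_mul, h1, h2, leviPoly]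
    simp [f]
    ring
  rw [he, MulEquiv.prime_iff]
  refine (irreducible_mul_X_add _ _ _ (X_ne_zero _) (by simp [vars_X]) (fun hx => ?_) ?_).prime
  · rw [dz_quad, dzb_quad, two_mul_C] at hx
    rcases Finset.mem_union.1 (vars_mul _ _ hx) with hx | hx <;>
    exact notMem_vars_linear (by simp [hab]) (by simp [hab]) _ hx
  · refine ((X_prime (R := ℂ) (i := (Sum.inl a : Fin n ⊕ Fin n))).irreducible.isRelPrime_iff_not_dvd).2
      fun hdvd => ?_
    have := map_dvd (aeval (fun x : Fin n ⊕ Fin n => if x = Sum.inl a then (0 : ℂ) else 1)) hdvd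
    rw [dz_quad, dzb_quad] at this
    simp [hab.symm] at this
    have h1 : (1 + 2 * (lam b : ℂ)) ≠ 0 := by
      have : (1 + 2 * lam b) ≠ 0 := by linarith [hlam b]
      exact_mod_cast this
    exact h1 this

end Quad

/-! ### Divisibility by the Levi form -/

section EulerOperator

variable {σ : Type*} {a b : σ}

/-- The partial Euler operator `X_a ∂_a + X_b ∂_b`. -/
noncomputable def euler (a b : σ) : Derivation ℂ (MvPolynomial σ ℂ) (MvPolynomial σ ℂ) :=
  (X a : MvPolynomial σ ℂ) • pderiv a + (X b : MvPolynomial σ ℂ) • pderiv b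

lemma euler_apply (p : MvPolynomial σ ℂ) :
    euler a b p = X a * pderiv a p + X b * pderiv b p := rfl

lemma coeff_X_mul_pderiv (a : σ) (p : MvPolynomial σ ℂ) (s : σ →₀ ℕ) :
    coeff s (X a * pderiv a p) = s a * coeff s p := by
  classical
  rw [coeff_X_mul']
  split_ifs with h
  · have h1 : s - Finsupp.single a 1 + Finsupp.single a 1 = s :=
      tsub_add_cancel_of_le (by simpa [Nat.one_le_iff_ne_zero] using h)
    have h2 : s a ≠ 0 := by simpa using h
    rw [coeff_pderiv, h1]
    have : (((s - Finsupp.single a 1 : σ →₀ ℕ) a : ℕ) : ℂ) + 1 = s a := by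
      have : (s - Finsupp.single a 1 : σ →₀ ℕ) a + 1 = s a := by simp; omega
      exact_mod_cast this
    rw [mul_comm, this]
  · have h2 : s a = 0 := by simpa using h
    simp [h2]

lemma coeff_euler (p : MvPolynomial σ ℂ) (s : σ →₀ ℕ) :
    coeff s (euler a b p) = ((s a + s b : ℕ) : ℂ) * coeff s p := by
  rw [euler_apply, coeff_add, coeff_X_mul_pderiv, coeff_X_mul_pderiv]; push_cast; ring

lemma euler_add_injective {p : MvPolynomial σ ℂ} (h : euler a b p + p = 0) : p = 0 := by
  ext s
  have := congrArg (coeff s) h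
  rw [coeff_add, coeff_euler, coeff_zero] at this
  have h1 : (((s a + s b : ℕ) : ℂ) + 1) * coeff s p = 0 := by linear_combination this
  exact (mul_eq_zero.1 h1).resolve_left (Nat.cast_add_one_ne_zero _)

lemma euler_add_surjective (h : MvPolynomial σ ℂ) : ∃ p, euler a b p + 2 * p = h := by
  classical
  refine ⟨∑ s ∈ h.support, monomial s (coeff s h / (((s a + s b : ℕ) : ℂ) + 2)), ?_⟩
  ext s
  have h2 : (((s a + s b : ℕ) : ℂ) + 2) ≠ 0 := by
    exact_mod_cast (Nat.succ_ne_zero (s a + s b + 1))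
  have hc : coeff s (∑ s ∈ h.support, monomial s (coeff s h / (((s a + s b : ℕ) : ℂ) + 2)))
      = coeff s h / (((s a + s b : ℕ) : ℂ) + 2) := by
    simp only [coeff_sum, coeff_monomial, Finset.sum_ite_eq', mem_support_iff]
    split_ifs with h0
    · rfl
    · rw [not_not] at h0; simp [h0]
  rw [two_mul, ← two_mul, coeff_add, coeff_euler,
    show (2 : MvPolynomial σ ℂ) = C 2 from (map_ofNat C 2).symm, coeff_C_mul, hc]
  field_simp

/-- The operator `1 + euler` preserves the ideal generated by an eigenvector of `euler`, and is
bijective on it. -/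
lemma dvd_of_dvd_euler_add {P g : MvPolynomial σ ℂ} (hP : euler a b P = P)
    (h : P ∣ euler a b g + g) : P ∣ g := by
  obtain ⟨h, hh⟩ := h
  obtain ⟨p, rfl⟩ := euler_add_surjective (a := a) (b := b) h
  refine ⟨p, sub_eq_zero.1 (euler_add_injective (a := a) (b := b) ?_)⟩
  rw [map_sub, Derivation.leibniz, hP, smul_eq_mul, smul_eq_mul]
  linear_combination hh

end EulerOperator

section LeviForm

variable {lam : Fin n → ℝ}

/-- The mixed Hessian of `E` in the two tangential directions `q_a ∂_b - q_b ∂_a` and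
`q_ā ∂_b̄ - q_b̄ ∂_ā`. -/
noncomputable abbrev hessRot (lam : Fin n → ℝ) (a b : Fin n) (E : Poly n) : Poly n :=
  hess dz dzb E (rot (dz · (quad lam)) a b) (rot (dzb · (quad lam)) a b)

lemma hessRot_quad {a b : Fin n} (hab : a ≠ b) : hessRot lam a b (quad lam) = leviPoly lam a b := by
  rw [hessRot, hess_rot, leviPoly]
  simp only [dz_dzb_quad, hab, hab.symm, if_true, if_false]
  ring

/-- The third-order bracket condition, along the single field `L = q_a ∂_b - q_b ∂_a`. -/
lemma leviPoly_mul_sub {a b : Fin n} (hab : a ≠ b) {E : Poly n}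
    (h : leviPoly lam a b * third dz dzb E (rot (dz · (quad lam)) a b) (rot (dzb · (quad lam)) a b)
        (rot (dz · (quad lam)) a b)
      = hessRot lam a b E * third dz dzb (quad lam) (rot (dz · (quad lam)) a b)
        (rot (dzb · (quad lam)) a b) (rot (dz · (quad lam)) a b)) :
    leviPoly lam a b * (along dz (rot (dz · (quad lam)) a b) (hessRot lam a b E)
      - (dz a (quad lam) * (dz a (quad lam) * dz b (dzb a E) + dz b (quad lam) * dz b (dzb b E))
        - dz b (quad lam) * (dz a (quad lam) * dz a (dzb a E) + dz b (quad lam) * dz a (dzb b E))))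
      = hessRot lam a b E * along dz (rot (dz · (quad lam)) a b) (leviPoly lam a b) := by
  have ht : (fun j => along dz (rot (dz · (quad lam)) a b) (rot (dzb · (quad lam)) a b j)) =
      fun j => (if j = a then -dz a (quad lam) else 0) + (if j = b then -dz b (quad lam) else 0) := by
    ext1 j
    rw [rot, map_sub]
    by_cases hja : j = a
    · subst hja
      simp [along_rot, dz_dzb_quad, hab]
    · by_cases hjb : j = b
      · subst hjb
        simp [along_rot, dz_dzb_quad, hab.symm]
      · simp [hja, hjb]
  have hs : ∀ v : Fin n → Poly n, ∑ j, ((if j = a then -dz a (quad lam) else 0)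
      + (if j = b then -dz b (quad lam) else 0)) * v j
      = -(dz a (quad lam) * v a + dz b (quad lam) * v b) := by
    intro v
    simp [add_mul, Finset.sum_add_distrib]; ring
  have hτ : ∀ f : Poly n, hess dz dzb f (rot (dz · (quad lam)) a b)
      (fun j => along dz (rot (dz · (quad lam)) a b) (rot (dzb · (quad lam)) a b j))
      = -(dz a (quad lam) * (dz a (quad lam) * dz b (dzb a f) + dz b (quad lam) * dz b (dzb b f))
        - dz b (quad lam) * (dz a (quad lam) * dz a (dzb a f)
          + dz b (quad lam) * dz a (dzb b f))) := by
    intro f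
    rw [ht, hess_eq]
    simp only [hs, sum_rot_mul]
    ring
  rw [third, third, hτ, hτ] at h
  change _ = hessRot lam a b E * (along dz (rot (dz · (quad lam)) a b) (hessRot lam a b (quad lam)) + _)
    at h
  rw [hessRot_quad hab] at h
  simp only [dz_dzb_quad, hab, hab.symm, if_true, if_false] at h
  linear_combination h

/-- The third-order condition forces the Levi form to divide the mixed Hessian of `E`. The Levi form
is prime and in general does not divide its own derivative along `L`. If `λ_a = λ_b = 0` this
derivative vanishes, and divisibility comes from an identity between partial Euler operators. -/
lemma leviPoly_dvd_hessRot {a b : Fin n} (hab : a ≠ b) (hlam : ∀ i, 0 ≤ lam i)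
    (ha : lam a ≠ 1 / 2) {E : Poly n}
    (h : leviPoly lam a b * third dz dzb E (rot (dz · (quad lam)) a b) (rot (dzb · (quad lam)) a b)
        (rot (dz · (quad lam)) a b)
      = hessRot lam a b E * third dz dzb (quad lam) (rot (dz · (quad lam)) a b)
        (rot (dzb · (quad lam)) a b) (rot (dz · (quad lam)) a b)) :
    leviPoly lam a b ∣ hessRot lam a b E := by
  classical
  have hprime := leviPoly_prime hab hlam ha
  have hmain := leviPoly_mul_sub hab h
  have hLP : along dz (rot (dz · (quad lam)) a b) (leviPoly lam a b)
      = dz a (quad lam) * (2 * C (lam b : ℂ) * dzb b (quad lam))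
        - dz b (quad lam) * (2 * C (lam a : ℂ) * dzb a (quad lam)) := by
    rw [along_rot, leviPoly]
    simp only [map_add, Derivation.leibniz, dz_dzb_quad, dz_dz_quad, hab, hab.symm, if_true,
      if_false, smul_eq_mul]
    ring
  by_cases h0 : lam a = 0 ∧ lam b = 0
  · -- Both coefficients vanish: the Levi form is `z_a z̄_a + z_b z̄_b` and `L` annihilates it.
    obtain ⟨ha0, hb0⟩ := h0
    have hu : ∀ i, lam i = 0 → dz i (quad lam) = X (Sum.inr i) := fun i hi => by
      rw [dz_quad, hi]; simp
    have hu' : ∀ i, lam i = 0 → dzb i (quad lam) = X (Sum.inl i) := fun i hi => by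
      rw [dzb_quad, hi]; simp
    have hP : leviPoly lam a b = X (Sum.inr a) * X (Sum.inl a) + X (Sum.inr b) * X (Sum.inl b) := by
      rw [leviPoly, hu a ha0, hu b hb0, hu' a ha0, hu' b hb0]
    have hLP0 : along dz (rot (dz · (quad lam)) a b) (leviPoly lam a b) = 0 := by
      rw [hLP, ha0, hb0]; simp
    rw [hLP0, mul_zero] at hmain
    have h1 := (mul_eq_zero.1 hmain).resolve_left hprime.ne_zero
    set D := euler (Sum.inl a : Fin n ⊕ Fin n) (Sum.inl b) with hD
    set D' := euler (Sum.inr a : Fin n ⊕ Fin n) (Sum.inr b) with hD'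
    set s : Poly n := dz a (dzb a E) + dz b (dzb b E) with hs
    have hN : hessRot lam a b E = leviPoly lam a b * s - D (D' E) := by
      rw [hessRot, hess_rot, hu a ha0, hu b hb0, hu' a ha0, hu' b hb0, hP, hD, hD']
      simp only [euler_apply, map_add, Derivation.leibniz, smul_eq_mul, pderiv_X, Pi.single_apply,
        hs]
      simp
      ring
    have h2 : along dz (rot (dz · (quad lam)) a b) (D (D' E) + D' E)
        = leviPoly lam a b * along dz (rot (dz · (quad lam)) a b) s := by
      rw [hN, map_sub, Derivation.leibniz, hLP0, smul_zero, add_zero, smul_eq_mul] at h1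
      have h3 : along dz (rot (dz · (quad lam)) a b) (D' E)
          = dz a (quad lam) * (dz a (quad lam) * dz b (dzb a E) + dz b (quad lam) * dz b (dzb b E))
          - dz b (quad lam) * (dz a (quad lam) * dz a (dzb a E)
            + dz b (quad lam) * dz a (dzb b E)) := by
        rw [along_rot, hu a ha0, hu b hb0, hD']
        simp only [euler_apply, map_add, Derivation.leibniz, smul_eq_mul, pderiv_X, Pi.single_apply]
        simp
      rw [map_add, h3]
      linear_combination -h1
    have hdvd : leviPoly lam a b ∣ X (Sum.inr b) * D (D (D' E) + D' E) := by
      -- Modulo the Levi form, `z_a L` equals `-z̄_b D`.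
      refine ⟨dz b (D (D' E) + D' E) - X (Sum.inl a) * along dz (rot (dz · (quad lam)) a b) s, ?_⟩
      rw [along_rot, hu a ha0, hu b hb0] at h2
      rw [hD, euler_apply, ← hD]
      rw [hP] at h2 ⊢
      linear_combination -X (Sum.inl a) * h2
    have hX : ¬ leviPoly lam a b ∣ X (Sum.inr b) := by
      intro hd
      have := map_dvd (aeval (fun x : Fin n ⊕ Fin n => if x = Sum.inr b then (1 : ℂ) else 0)) hd
      rw [hP] at this
      simp at this
    have h4 := (hprime.dvd_or_dvd hdvd).resolve_left hX
    rw [map_add] at h4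
    have hDP : D (leviPoly lam a b) = leviPoly lam a b := by
      rw [hP, hD, euler_apply]
      simp [pderiv_X, Derivation.leibniz, hab, hab.symm]
      ring
    have h5 := dvd_of_dvd_euler_add hDP h4
    rw [hN]
    exact dvd_sub (dvd_mul_right _ _) h5
  · have hdvd : leviPoly lam a b ∣ hessRot lam a b E *
        along dz (rot (dz · (quad lam)) a b) (leviPoly lam a b) := ⟨_, hmain.symm⟩
    refine (hprime.dvd_or_dvd hdvd).resolve_right fun hd => ?_
    -- A point of `{leviPoly = 0}` at which the derivative along `L` is `2 (λ_a + λ_b)`.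
    have hla : (1 - 2 * (lam a : ℂ)) ≠ 0 := by
      have : (1 - 2 * lam a) ≠ 0 := fun h => ha (by linarith)
      exact_mod_cast this
    have hlb : (1 + 2 * (lam b : ℂ)) ≠ 0 := by
      have : (1 + 2 * lam b) ≠ 0 := by linarith [hlam b]
      exact_mod_cast this
    let pt : Fin n ⊕ Fin n → ℂ := fun x =>
      if x = Sum.inr a then (1 - 2 * (lam a : ℂ))⁻¹
      else if x = Sum.inl a then -(1 - 2 * (lam a : ℂ))⁻¹ else (1 + 2 * (lam b : ℂ))⁻¹
    have hd' := map_dvd (aeval pt) hd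
    have e1 : aeval pt (dz a (quad lam)) = 1 := by
      rw [dz_quad]
      simp [pt]
      field_simp
      ring
    have e2 : aeval pt (dzb a (quad lam)) = -1 := by
      rw [dzb_quad]
      simp [pt]
      field_simp
      ring
    have e3 : aeval pt (dz b (quad lam)) = 1 := by
      rw [dz_quad]
      simp [pt, hab.symm]
      field_simp
    have e4 : aeval pt (dzb b (quad lam)) = 1 := by
      rw [dzb_quad]
      simp [pt, hab.symm]
      field_simp
    rw [hLP, leviPoly] at hd'
    simp only [map_add, map_sub, map_mul, e1, e2, e3, e4, map_ofNat, aeval_C] at hd'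
    simp at hd'
    have h6 : 2 * lam b + 2 * lam a = 0 := by exact_mod_cast hd'
    exact h0 ⟨by linarith [hlam a, hlam b], by linarith [hlam a, hlam b]⟩

end LeviForm

/-! ### The linearized problem -/

section Splitting

/-- A polynomial whose derivatives in the variables outside the range of `f` vanish is a polynomial
in the variables `f i`. -/
lemma exists_rename_of_pderiv_eq_zero {σ τ : Type*} {f : σ → τ} (hf : Function.Injective f)
    {p : MvPolynomial τ ℂ} (h : ∀ x, x ∉ Set.range f → pderiv x p = 0) :
    ∃ c : MvPolynomial σ ℂ, rename f c = p := by
  classical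
  refine exists_rename_eq_of_vars_subset_range p f hf fun x hx => ?_
  by_contra hxr
  obtain ⟨s, hs, hxs⟩ := (mem_vars_iff_mem_support x).1 hx
  have h1 := coeff_X_mul_pderiv x p s
  rw [h x hxr, mul_zero, coeff_zero] at h1
  exact (mul_ne_zero (Nat.cast_ne_zero.2 (Finsupp.mem_support_iff.1 hxs))
    (mem_support_iff.1 hs)) h1.symm

lemma dzb_rename_inl (c : MvPolynomial (Fin n) ℂ) (j : Fin n) : dzb j (rename Sum.inl c) = 0 := by
  classical
  refine pderiv_eq_zero_of_notMem_vars fun hx => ?_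
  have := vars_rename _ _ hx
  simp at this

lemma dz_rename_inr (c : MvPolynomial (Fin n) ℂ) (j : Fin n) : dz j (rename Sum.inr c) = 0 := by
  classical
  refine pderiv_eq_zero_of_notMem_vars fun hx => ?_
  have := vars_rename _ _ hx
  simp at this

/-- A homogeneous pluriharmonic polynomial is the sum of a holomorphic and an antiholomorphic one. -/
lemma exists_add_of_pluriharmonic {m : ℕ} {E : Poly n} (hE : E.IsHomogeneous m)
    (h : ∀ i j, dz i (dzb j E) = 0) : ∃ c d : MvPolynomial (Fin n) ℂ,
      c.IsHomogeneous m ∧ d.IsHomogeneous m ∧ E = rename Sum.inl c + rename Sum.inr d := by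
  classical
  rcases m with _ | m
  · rw [← totalDegree_zero_iff_isHomogeneous, totalDegree_eq_zero_iff_eq_C] at hE
    exact ⟨C (coeff 0 E), 0, isHomogeneous_C _ _, isHomogeneous_zero _ _ _, by simp [← hE]⟩
  have hm : ((m : ℂ) + 1) ≠ 0 := Nat.cast_add_one_ne_zero m
  have hsum := hE.sum_X_mul_pderiv
  rw [Fintype.sum_sum_type, nsmul_eq_mul] at hsum
  obtain ⟨c, hc⟩ := exists_rename_of_pderiv_eq_zero (f := (Sum.inl : Fin n → Fin n ⊕ Fin n))
    Sum.inl_injective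
    (p := C ((m : ℂ) + 1)⁻¹ * ∑ i, X (Sum.inl i) * pderiv (Sum.inl i) E) (by
      rintro (i | i) hi
      · exact absurd ⟨i, rfl⟩ hi
      · rw [pderiv_C_mul, map_sum, Finset.sum_eq_zero, mul_zero]
        intro j _
        rw [Derivation.leibniz, pderiv_comm, h]
        simp [pderiv_X])
  obtain ⟨d, hd⟩ := exists_rename_of_pderiv_eq_zero (f := (Sum.inr : Fin n → Fin n ⊕ Fin n))
    Sum.inr_injective
    (p := C ((m : ℂ) + 1)⁻¹ * ∑ i, X (Sum.inr i) * pderiv (Sum.inr i) E) (by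
      rintro (i | i) hi
      · rw [pderiv_C_mul, map_sum, Finset.sum_eq_zero, mul_zero]
        intro j _
        rw [Derivation.leibniz, h]
        simp [pderiv_X]
      · exact absurd ⟨i, rfl⟩ hi)
  have hhom : ∀ a : Fin n ⊕ Fin n, (X a * pderiv a E).IsHomogeneous (m + 1) := by
    intro a
    rw [add_comm]
    exact (isHomogeneous_X _ _).mul (by simpa using hE.pderiv (i := a))
  refine ⟨c, d, ?_, ?_, ?_⟩
  · rw [← IsHomogeneous.rename_isHomogeneous_iff Sum.inl_injective, hc]
    exact IsHomogeneous.C_mul (IsHomogeneous.sum _ _ _ fun i _ => hhom _) _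
  · rw [← IsHomogeneous.rename_isHomogeneous_iff Sum.inr_injective, hd]
    exact IsHomogeneous.C_mul (IsHomogeneous.sum _ _ _ fun i _ => hhom _) _
  · rw [hc, hd, ← mul_add, hsum, ← mul_assoc,
      show ((m + 1 : ℕ) : Poly n) = C ((m : ℂ) + 1) by simp, ← C_mul, inv_mul_cancel₀ hm, C_1,
      one_mul]

lemma homogeneousComponent_mul_of_isHomogeneous {σ : Type*} {p r : MvPolynomial σ ℂ} {k : ℕ}
    (hr : r.IsHomogeneous k) (m : ℕ) :
    homogeneousComponent (m + k) (p * r) = homogeneousComponent m p * r := by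
  conv_lhs => rw [← sum_homogeneousComponent p, Finset.sum_mul, map_sum]
  rw [Finset.sum_eq_single m]
  · exact homogeneousComponent_eq_self ((homogeneousComponent_isHomogeneous m p).mul hr)
  · intro i _ him
    rw [homogeneousComponent_of_mem ((homogeneousComponent_isHomogeneous i p).mul hr),
      if_neg (by omega)]
  · intro hm
    rw [homogeneousComponent_eq_self ((homogeneousComponent_isHomogeneous m p).mul hr),
      homogeneousComponent_eq_zero m p (by simpa using hm), zero_mul]

lemma IsHomogeneous.of_mul_right {σ : Type*} {p r : MvPolynomial σ ℂ} {k m : ℕ}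
    (hr : r.IsHomogeneous k) (hr0 : r ≠ 0) (h : (p * r).IsHomogeneous (m + k)) :
    p.IsHomogeneous m := by
  have := homogeneousComponent_mul_of_isHomogeneous (p := p) hr m
  rw [homogeneousComponent_eq_self h] at this
  rw [mul_right_cancel₀ hr0 this]
  exact homogeneousComponent_isHomogeneous m p

variable {lam : Fin n → ℝ}

lemma hessRot_isHomogeneous (a b : Fin n) {m : ℕ} {E : Poly n} (hE : E.IsHomogeneous m)
    (hm : 2 ≤ m) : (hessRot lam a b E).IsHomogeneous m := by
  have h1 : ∀ i, (dz i (quad lam)).IsHomogeneous 1 := fun i => (quad_isHomogeneous lam).pderiv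
  have h2 : ∀ i, (dzb i (quad lam)).IsHomogeneous 1 := fun i => (quad_isHomogeneous lam).pderiv
  have h3 : ∀ i j, (dz i (dzb j E)).IsHomogeneous (m - 2) := fun i j => by
    rw [show m - 2 = m - 1 - 1 by omega]; exact hE.pderiv.pderiv
  have h4 : m = 1 + (1 + (m - 2)) := by omega
  rw [hessRot, hess_rot, h4]
  exact ((h1 _).mul (((h2 _).mul (h3 _ _)).sub ((h2 _).mul (h3 _ _)))).sub
    ((h1 _).mul (((h2 _).mul (h3 _ _)).sub ((h2 _).mul (h3 _ _))))

lemma leviPoly_isHomogeneous (a b : Fin n) : (leviPoly lam a b).IsHomogeneous 2 :=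
  (((quad_isHomogeneous lam).pderiv (i := Sum.inl a)).mul
    ((quad_isHomogeneous lam).pderiv (i := Sum.inr a))).add
  (((quad_isHomogeneous lam).pderiv (i := Sum.inl b)).mul
    ((quad_isHomogeneous lam).pderiv (i := Sum.inr b)))

lemma IsFlatSol.hessRot_eq {a b : Fin n} (hab : a ≠ b) {E κ κ' : Poly n}
    (h : IsFlatSol dz dzb (quad lam) E κ κ') : hessRot lam a b E = κ * leviPoly lam a b := by
  have h' : ∀ i j, dz i (dzb j E) = (if i = j then κ else 0) + dz i κ * dzb j (quad lam)
    + dz i (quad lam) * dzb j κ - κ' * (dz i (quad lam) * dzb j (quad lam)) := h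
  rw [hessRot, hess_rot, leviPoly, h', h', h', h']
  simp only [hab, hab.symm, if_true, if_false]
  ring

/-- A solution whose first multiplier vanishes is pluriharmonic, because the second multiplier then
vanishes too. -/
lemma IsFlatSol.pluriharmonic (hn : 2 ≤ n) {a b : Fin n} (hab : a ≠ b)
    (hP : leviPoly lam a b ≠ 0) {E κ' : Poly n} (h : IsFlatSol dz dzb (quad lam) E 0 κ') (i j : Fin n) :
    dz i (dzb j E) = 0 := by
  obtain ⟨κ'', h2⟩ := h.multiplier (i0 := a)
    (by rw [dz_quad, two_mul_C]; exact (prime_linear (by simp) _).ne_zero)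
    (fun i j f => pderiv_comm _ _ f) (fun i j f => pderiv_comm _ _ f)
    (fun i j f => pderiv_comm _ _ f) (dz_dzb_quad lam) (isUnimodularLike_dz lam hn)
    (isUnimodularLike_dzb lam hn)
  have h3 := h2.hessRot_eq hab
  have h4 : hessRot lam a b (0 : Poly n) = 0 := by rw [hessRot, hess_rot]; simp
  rw [h4] at h3
  have h5 := (mul_eq_zero.1 h3.symm).resolve_right hP
  have := h i j
  rw [h5] at this
  simpa using this

/-- Homogeneous solutions of the linearized system are the sums of a holomorphic and an
antiholomorphic polynomial in `(z, q)` and `(z̄, q)`. The multiplier `κ` is again a solution, of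
degree lower by two; integrating it in `q` reduces to the pluriharmonic case. -/
lemma IsFlatSol.exists_decomposition (hn : 2 ≤ n) {a b : Fin n} (hab : a ≠ b)
    (hP : leviPoly lam a b ≠ 0) {m : ℕ} {E κ κ' : Poly n} (hE : E.IsHomogeneous m)
    (h : IsFlatSol dz dzb (quad lam) E κ κ') : ∃ c d : ℕ → MvPolynomial (Fin n) ℂ,
      (∀ j, 2 * j ≤ m → (c j).IsHomogeneous (m - 2 * j) ∧ (d j).IsHomogeneous (m - 2 * j)) ∧
      E = ∑ j ∈ Finset.range (m / 2 + 1),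
        (rename Sum.inl (c j) + rename Sum.inr (d j)) * quad lam ^ j := by
  induction m using Nat.strong_induction_on generalizing E κ κ' with
  | _ m ih =>
  by_cases hm : m < 2
  · have hzero : ∀ i j, dz i (dzb j E) = 0 := by
      intro i j
      have h1 : (dzb j E).totalDegree = 0 := by
        have h2 : (dzb j E).totalDegree ≤ m - 1 := (hE.pderiv (i := Sum.inr j)).totalDegree_le
        omega
      rw [totalDegree_eq_zero_iff_eq_C] at h1
      rw [h1, pderiv_C]
    obtain ⟨c, d, hc, hd, hcd⟩ := exists_add_of_pluriharmonic hE hzero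
    refine ⟨fun _ => c, fun _ => d, fun j hj => ?_, ?_⟩
    · obtain rfl : j = 0 := by omega
      exact ⟨hc, hd⟩
    · rw [show m / 2 = 0 by omega]
      simpa using hcd
  · obtain ⟨m, rfl⟩ : ∃ k, m = k + 2 := ⟨m - 2, by omega⟩
    have hκ : κ.IsHomogeneous m := by
      refine IsHomogeneous.of_mul_right (leviPoly_isHomogeneous a b) hP ?_
      rw [← h.hessRot_eq hab]
      exact hessRot_isHomogeneous a b hE (by omega)
    obtain ⟨κ'', h2⟩ := h.multiplier (i0 := a)
      (by rw [dz_quad, two_mul_C]; exact (prime_linear (by simp) _).ne_zero)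
      (fun i j f => pderiv_comm _ _ f) (fun i j f => pderiv_comm _ _ f)
      (fun i j f => pderiv_comm _ _ f) (dz_dzb_quad lam) (isUnimodularLike_dz lam hn)
      (isUnimodularLike_dzb lam hn)
    obtain ⟨c, d, hcd, hsum⟩ := ih m (by omega) hκ h2
    have hterm : ∀ j : ℕ, ∃ μ, IsFlatSol dz dzb (quad lam)
        ((rename Sum.inl (C ((j : ℂ) + 1)⁻¹ * c j) + rename Sum.inr (C ((j : ℂ) + 1)⁻¹ * d j))
          * quad lam ^ (j + 1)) ((rename Sum.inl (c j) + rename Sum.inr (d j)) * quad lam ^ j) μ := by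
      intro j
      have hj : ((j : ℂ) + 1) ≠ 0 := Nat.cast_add_one_ne_zero j
      have e := ((isFlatSol_left (dz_dzb_quad lam) (dzb_rename_inl (c j)) j).add
        (isFlatSol_right (fun i j f => pderiv_comm _ _ f) (dz_dzb_quad lam)
          (dz_rename_inr (d j)) j)).smul ((j : ℂ) + 1)⁻¹
      have ea : (rename Sum.inl (C ((j : ℂ) + 1)⁻¹ * c j) + rename Sum.inr (C ((j : ℂ) + 1)⁻¹ * d j))
          * quad lam ^ (j + 1) = ((j : ℂ) + 1)⁻¹ • (rename Sum.inl (c j) * quad lam ^ (j + 1)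
            + rename Sum.inr (d j) * quad lam ^ (j + 1)) := by
        rw [smul_eq_C_mul, map_mul, map_mul, rename_C, rename_C]; ring
      have eb : (rename Sum.inl (c j) + rename Sum.inr (d j)) * quad lam ^ j
          = ((j : ℂ) + 1)⁻¹ • (((j : Poly n) + 1) * (rename Sum.inl (c j) * quad lam ^ j)
            + ((j : Poly n) + 1) * (rename Sum.inr (d j) * quad lam ^ j)) := by
        rw [smul_eq_C_mul, show ((j : Poly n) + 1) = C ((j : ℂ) + 1) by simp,
          ← mul_add, ← mul_assoc, ← C_mul, inv_mul_cancel₀ hj, C_1, one_mul, add_mul]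
      exact ⟨_, by rw [ea, eb]; exact e⟩
    choose μ hμ using hterm
    have hs := IsFlatSol.sum (Finset.range (m / 2 + 1)) fun j _ => hμ j
    rw [← hsum] at hs
    have hdiff := h.sub hs
    rw [sub_self] at hdiff
    have hqh : ∀ j, 2 * j ≤ m → ((rename Sum.inl (C ((j : ℂ) + 1)⁻¹ * c j)
        + rename Sum.inr (C ((j : ℂ) + 1)⁻¹ * d j))
          * quad lam ^ (j + 1)).IsHomogeneous (m + 2) := by
      intro j hj
      have h3 := ((quad_isHomogeneous lam).pow (j + 1))
      rw [show m + 2 = (m - 2 * j) + 2 * (j + 1) by omega]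
      refine IsHomogeneous.mul (IsHomogeneous.add ?_ ?_) h3
      · exact (IsHomogeneous.C_mul (hcd j hj).1 _).rename_isHomogeneous
      · exact (IsHomogeneous.C_mul (hcd j hj).2 _).rename_isHomogeneous
    obtain ⟨c0, d0, hc0, hd0, h0⟩ := exists_add_of_pluriharmonic
      (hE.sub (IsHomogeneous.sum (Finset.range (m / 2 + 1)) _ _ fun j hj => hqh j (by
        rw [Finset.mem_range] at hj; omega))) (hdiff.pluriharmonic hn hab hP)
    refine ⟨fun j => Nat.casesOn j c0 fun j => C ((j : ℂ) + 1)⁻¹ * c j,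
      fun j => Nat.casesOn j d0 fun j => C ((j : ℂ) + 1)⁻¹ * d j, fun j hj => ?_, ?_⟩
    · rcases j with _ | j
      · exact ⟨hc0, hd0⟩
      · rw [show m + 2 - 2 * (j + 1) = m - 2 * j by omega]
        exact ⟨IsHomogeneous.C_mul (hcd j (by omega)).1 _,
          IsHomogeneous.C_mul (hcd j (by omega)).2 _⟩
    · rw [show (m + 2) / 2 + 1 = (m / 2 + 1) + 1 by omega, Finset.sum_range_succ']
      simp only [pow_zero, mul_one]
      change E = _ + (rename Sum.inl c0 + rename Sum.inr d0)
      rw [← h0]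
      ring

/-- A homogeneous polynomial satisfying the second- and third-order bracket conditions solves the
linearized system. -/
lemma exists_isFlatSol (hn : 2 ≤ n) (hlam : ∀ i, 0 ≤ lam i) {a b : Fin n} (hab : a ≠ b)
    (ha : lam a ≠ 1 / 2) {E : Poly n}
    (h1 : ∀ k l k' l', leviPoly lam a b
        * hess dz dzb E (rot (dz · (quad lam)) k l) (rot (dzb · (quad lam)) k' l')
      = hessRot lam a b E
        * hess dz dzb (quad lam) (rot (dz · (quad lam)) k l) (rot (dzb · (quad lam)) k' l'))
    (h2 : ∀ k l, leviPoly lam a b * third dz dzb E (rot (dz · (quad lam)) a b)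
        (rot (dzb · (quad lam)) a b) (rot (dz · (quad lam)) k l)
      = hessRot lam a b E * third dz dzb (quad lam) (rot (dz · (quad lam)) a b)
        (rot (dzb · (quad lam)) a b) (rot (dz · (quad lam)) k l))
    (h3 : ∀ k l, leviPoly lam a b * third dzb dz E (rot (dzb · (quad lam)) a b)
        (rot (dz · (quad lam)) a b) (rot (dzb · (quad lam)) k l)
      = hessRot lam a b E * third dzb dz (quad lam) (rot (dzb · (quad lam)) a b)
        (rot (dz · (quad lam)) a b) (rot (dzb · (quad lam)) k l)) :
    ∃ κ κ', IsFlatSol dz dzb (quad lam) E κ κ' := by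
  have hP := (leviPoly_prime hab hlam ha).ne_zero
  obtain ⟨κ, hκ⟩ := leviPoly_dvd_hessRot hab hlam ha (h2 a b)
  simp only [hκ, mul_assoc] at h1 h2 h3
  have g1 := fun k l k' l' => mul_left_cancel₀ hP (h1 k l k' l')
  have g2 := fun k l => mul_left_cancel₀ hP (h2 k l)
  have g3 := fun k l => mul_left_cancel₀ hP (h3 k l)
  have hswap : ∀ i j (f : Poly n), dz i (dzb j f) = dzb j (dz i f) := fun i j f => pderiv_comm _ _ f
  have hq' : ∀ i j, dzb i (dz j (quad lam)) = if i = j then 1 else 0 := by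
    intro i j; rw [← hswap, dz_dzb_quad]; simp [eq_comm]
  have r1 := remainder_proportional hab (dz_dzb_quad lam) hP g1 g2
  have r2 := remainder_proportional (d := dzb) (d' := dz) (κ := κ) hab hq' (by
    rw [leviPoly] at hP; simpa [mul_comm] using hP) (fun k l k' l' => by
      have := g1 k' l' k l
      rwa [← hess_swap hswap, ← hess_swap hswap] at this) g3
  obtain ⟨s, hs⟩ := exists_rank_one (i0 := a)
    (by rw [dz_quad, two_mul_C]; exact (prime_linear (by simp) _).ne_zero)
    (isUnimodularLike_dz lam hn) (isUnimodularLike_dzb lam hn)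
    (Ψ := fun i j => dz i (dzb j E) - (if i = j then κ else 0) - dz i κ * dzb j (quad lam)
      - dz i (quad lam) * dzb j κ) r1 (fun i k l => by
      have := r2 k l i
      simp only [← hswap, eq_comm (b := i)] at this
      linear_combination this)
  refine ⟨κ, -s, fun i j => ?_⟩
  have := hs i j
  linear_combination this

end Splitting

/-! ### Brackets of tangential vector fields -/

section Brackets

variable {A : Type*} [CommRing A] [Algebra ℂ A]

lemma along_along (d₁ d₂ : Fin n → Derivation ℂ A A) (X Y : Fin n → A) (f : A) :
    along d₁ X (along d₂ Y f) = along d₂ (fun j => along d₁ X (Y j)) f + hess d₁ d₂ f X Y := by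
  rw [along_apply d₂, along_apply d₂, map_sum, hess, Finset.sum_comm (s := Finset.univ (α := Fin n)),
    ← Finset.sum_add_distrib]
  refine Finset.sum_congr rfl fun j _ => ?_
  rw [Derivation.leibniz, along_apply d₁ X (d₂ j f), smul_eq_mul, smul_eq_mul, Finset.mul_sum,
    add_comm, mul_comm (d₂ j f)]
  congr 1
  exact Finset.sum_congr rfl fun i _ => by ring

/-- If `ψ` vanishes on a set to which the fields `X, Z` of type `(1,0)` and `Y` of type `(0,1)` are
tangent (so that `J`, the functions vanishing on it, is stable under them) and `∂ψ = α ∂G'`,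
`∂'ψ = β ∂'G` at a point, then evaluating `[X, Y] ψ` and `[Z, [X, Y]] ψ` there gives two linear
relations between `α` and `β`. -/
lemma bracket_relations {d d' : Fin n → Derivation ℂ A A}
    (hdd : ∀ i j f, d i (d j f) = d j (d i f)) (hdd' : ∀ i j f, d i (d' j f) = d' j (d i f))
    {J : AddSubgroup A} {e : A →ₐ[ℂ] ℂ} (he : ∀ f ∈ J, e f = 0) {ψ G G' : A} (hψ : ψ ∈ J)
    {α β : ℂ} (hα : ∀ i, e (d i ψ) = α * e (d i G')) (hβ : ∀ i, e (d' i ψ) = β * e (d' i G))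
    {X Y Z : Fin n → A} (hX : along d X G' = 0) (hY : along d' Y G = 0) (hZ : along d Z G' = 0)
    (hXJ : ∀ f ∈ J, along d X f ∈ J) (hYJ : ∀ f ∈ J, along d' Y f ∈ J)
    (hZJ : ∀ f ∈ J, along d Z f ∈ J) :
    α * e (hess d d' G' X Y) = β * e (hess d d' G X Y) ∧
      α * e (third d d' G' X Y Z) = β * e (third d d' G X Y Z) := by
  have hd'd : ∀ i j f, d' i (d j f) = d j (d' i f) := fun i j f => (hdd' j i f).symm
  have eα : ∀ V, e (along d V ψ) = α * e (along d V G') := by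
    intro V
    simp only [along_apply, map_sum, map_mul, hα, Finset.mul_sum]
    exact Finset.sum_congr rfl fun i _ => by ring
  have eβ : ∀ V, e (along d' V ψ) = β * e (along d' V G) := by
    intro V
    simp only [along_apply, map_sum, map_mul, hβ, Finset.mul_sum]
    exact Finset.sum_congr rfl fun i _ => by ring
  set XY : Fin n → A := fun j => along d X (Y j) with hXY
  set YX : Fin n → A := fun j => along d' Y (X j) with hYX
  have hbr : ∀ f, along d' XY f - along d YX f = along d X (along d' Y f) - along d' Y (along d X f) := by
    intro f
    rw [along_along, along_along, hess_swap hdd']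
    ring
  have hTJ : ∀ f ∈ J, along d' XY f - along d YX f ∈ J := fun f hf => by
    rw [hbr]
    exact J.sub_mem (hXJ _ (hYJ _ hf)) (hYJ _ (hXJ _ hf))
  have gXY : along d' XY G = -hess d d' G X Y := by
    have := along_along d d' X Y G
    rw [hY, map_zero] at this
    linear_combination -this
  have gYX : along d YX G' = -hess d d' G' X Y := by
    have := along_along d' d Y X G'
    rw [hX, map_zero, hess_swap hdd'] at this
    linear_combination -this
  constructor
  · have h := he _ (hTJ ψ hψ)
    rw [map_sub, eα, eβ, gXY, gYX, map_neg, map_neg] at h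
    linear_combination h
  · have h := he _ (J.sub_mem (hZJ _ (hTJ ψ hψ)) (hTJ _ (hZJ _ hψ)))
    rw [map_sub (along d Z), along_along d d' Z XY, along_along d d Z YX, along_along d' d XY Z,
      along_along d d YX Z, hess_swap hdd', hess_swap hdd] at h
    simp only [map_add, map_sub, eα, eβ] at h
    have k1 := along_along d d' Z XY G
    have k2 := along_along d d Z YX G'
    have k3 := along_along d' d XY Z G'
    have k4 := along_along d d YX Z G'
    rw [gXY, map_neg] at k1
    rw [gYX, map_neg] at k2
    rw [hZ, map_zero, hess_swap hdd'] at k3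
    rw [hZ, map_zero, hess_swap hdd] at k4
    have e1 := congrArg e k1
    have e2 := congrArg e k2
    have e3 := congrArg e k3
    have e4 := congrArg e k4
    simp only [map_add, map_neg, map_zero] at e1 e2 e3 e4
    simp only [third, map_add]
    linear_combination h + β * e1 - α * e2 - α * e3 + α * e4

end Brackets

open SmoothFn

/-! ### Non-minimal points -/

section Geometry

/-- A function that is smooth near a point agrees near that point with a globally smooth one. -/
lemma exists_smoothFn_eventuallyEq {f : (Fin n → ℂ) → ℂ} {U : Set (Fin n → ℂ)} (hU : IsOpen U)
    {z₀ : Fin n → ℂ} (hz₀ : z₀ ∈ U) (hf : ContDiffOn ℝ ∞ f U) :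
    ∃ g : SmoothFn n, (g : (Fin n → ℂ) → ℂ) =ᶠ[𝓝 z₀] f := by
  obtain ⟨r, hr, hrU⟩ := Metric.isOpen_iff.1 hU z₀ hz₀
  let χ : ContDiffBump z₀ := ⟨r / 4, r / 2, by positivity, by linarith⟩
  have hg : ContDiff ℝ ∞ (fun z => (χ z : ℂ) * f z) := by
    rw [contDiff_iff_contDiffAt]
    intro z
    by_cases hz : z ∈ U
    · exact (Complex.ofRealCLM.contDiff.contDiffAt.comp z χ.contDiffAt).mul
        (hf.contDiffAt (hU.mem_nhds hz))
    · have h1 : z ∉ tsupport χ := by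
        rw [χ.tsupport_eq]
        refine fun h => hz (hrU ?_)
        have : dist z z₀ ≤ r / 2 := h
        exact lt_of_le_of_lt this (by linarith)
      refine (contDiffAt_const (c := (0 : ℂ))).congr_of_eventuallyEq ?_
      filter_upwards [notMem_tsupport_iff_eventuallyEq.1 h1] with y hy
      rw [hy]; simp
  refine ⟨⟨_, hg⟩, ?_⟩
  filter_upwards [χ.eventuallyEq_one] with y hy
  simp [hy]

lemma realTangent_mono {S M : Set (CSpace n)} (h : S ⊆ M) (x : CSpace n) :
    realTangent S x ≤ realTangent M x :=
  Submodule.span_mono fun _ ⟨γ, h0, hγ, hd⟩ => ⟨γ, h0, hγ.mono fun _ ht => h ht, hd⟩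

lemma tangentOneZero_mono {S M : Set (CSpace n)} (h : S ⊆ M) (x : CSpace n) :
    tangentOneZero S x ≤ tangentOneZero M x :=
  fun _ hv => ⟨realTangent_mono h x hv.1, realTangent_mono h x hv.2⟩

/-- The vectors tangent to the graph of a smooth function. -/
lemma graph_tangent {M W : Set (CSpace n)} (hW : IsOpen W) {F : SmoothFn n}
    (hM : ∀ x ∈ W, (x ∈ M ↔ x.2 = F x.1)) {z : Fin n → ℂ} (hz : ((z, F z) : CSpace n) ∈ W)
    (a : Fin n → ℂ) : ((a, SmoothFn.dirDeriv a F z) : CSpace n) ∈ realTangent M (z, F z) := by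
  refine Submodule.subset_span ⟨fun t => (z + t • a, F (z + t • a)), by simp, ?_, ?_⟩
  · have hc : Continuous fun t : ℝ => ((z + t • a, F (z + t • a)) : CSpace n) := by
      have h1 : Continuous fun t : ℝ => z + t • a := by fun_prop
      exact h1.prodMk ((SmoothFn.continuous F).comp h1)
    filter_upwards [(hc.tendsto 0).eventually (hW.mem_nhds (by simpa using hz))] with t ht
    exact (hM _ ht).2 rfl
  · have h1 : HasDerivAt (fun t : ℝ => z + t • a) a 0 := by
      simpa using ((hasDerivAt_id (0 : ℝ)).smul_const a).const_add z
    have h2 : HasFDerivAt F (fderiv ℝ F z) (z + (0 : ℝ) • a) := by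
      simpa using (SmoothFn.differentiable F z).hasFDerivAt
    exact h1.prodMk (h2.comp_hasDerivAt 0 h1)

/-- The differential of a function vanishing on `S` kills the vectors tangent to `S`. Here `S` lies
in the graph of `F`, and functions on the graph are functions of `z`. -/
lemma dirDeriv_eq_zero_of_mem_realTangent {M S W : Set (CSpace n)} (hW : IsOpen W) {F : SmoothFn n}
    (hM : ∀ x ∈ W, (x ∈ M ↔ x.2 = F x.1)) (hS : S ⊆ M) {z : Fin n → ℂ}
    (hz : ((z, F z) : CSpace n) ∈ W) {f : SmoothFn n}
    (hf : ∀ᶠ y in 𝓝 z, ((y, F y) : CSpace n) ∈ S → f y = 0) {v : CSpace n}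
    (hv : v ∈ realTangent S (z, F z)) : SmoothFn.dirDeriv v.1 f z = 0 := by
  let ℓ : CSpace n →ₗ[ℝ] ℂ := (fderiv ℝ f z).toLinearMap ∘ₗ LinearMap.fst ℝ _ _
  have hle : realTangent S (z, F z) ≤ LinearMap.ker ℓ := by
    refine Submodule.span_le.2 ?_
    rintro v ⟨γ, h0, hγ, hd⟩
    have hd1 : HasDerivAt (fun t => (γ t).1) v.1 0 := hd.fst
    have hf1 : HasFDerivAt f (fderiv ℝ f z) (γ 0).1 := by
      rw [h0]; exact (SmoothFn.differentiable f z).hasFDerivAt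
    have hcomp := hf1.comp_hasDerivAt (0 : ℝ) hd1
    have hzero : (f ∘ fun t => (γ t).1) =ᶠ[𝓝 0] fun _ => 0 := by
      have t1 : Tendsto γ (𝓝 0) (𝓝 (z, F z)) := by
        rw [← h0]; exact hd.continuousAt.tendsto
      have t2 : Tendsto (fun t => (γ t).1) (𝓝 0) (𝓝 z) := (continuous_fst.tendsto _).comp t1
      filter_upwards [hγ, t1.eventually (hW.mem_nhds hz), t2.eventually hf] with t h1 h2 h3
      have h4 := (hM _ h2).1 (hS h1)
      refine h3 ?_
      rw [← h4]
      exact h1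
    have := (hcomp.congr_of_eventuallyEq hzero.symm).unique (hasDerivAt_const 0 (0 : ℂ))
    exact this
  exact hle hv

/-- The derivation `∂/∂zᵢ` of the ring of smooth functions. -/
noncomputable abbrev dZ (n : ℕ) (i : Fin n) : Derivation ℂ (SmoothFn n) (SmoothFn n) := wirt (Sum.inl i)

/-- The derivation `∂/∂z̄ᵢ` of the ring of smooth functions. -/
noncomputable abbrev dZb (n : ℕ) (i : Fin n) : Derivation ℂ (SmoothFn n) (SmoothFn n) := wirt (Sum.inr i)

/-- The smooth functions of `z` whose lift to the graph of `F` vanishes on `S` near the point over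
`z₀`. -/
def vanishingNear (S : Set (CSpace n)) (F : SmoothFn n) (z₀ : Fin n → ℂ) :
    AddSubgroup (SmoothFn n) where
  carrier := {f | ∀ᶠ z in 𝓝 z₀, ((z, F z) : CSpace n) ∈ S → f z = 0}
  zero_mem' := Eventually.of_forall fun _ _ => rfl
  add_mem' := fun {f g} hf hg => by
    filter_upwards [hf, hg] with z h1 h2 hz
    rw [add_apply, h1 hz, h2 hz, add_zero]
  neg_mem' := fun {f} hf => by
    filter_upwards [hf] with z h1 hz
    rw [neg_apply, h1 hz, neg_zero]

lemma continuous_graph (F : SmoothFn n) : Continuous fun z => ((z, F z) : CSpace n) :=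
  continuous_id.prodMk (SmoothFn.continuous F)

/-- The tangent vectors of type `(1,0)` of `M`, i.e. the `a` with `∑ aᵢ ∂ᵢF̄ = 0`, annihilate together
with their conjugates every function vanishing on `S`, provided `S` has the same vectors of type
`(1,0)` as `M`. -/
lemma wirt_eq_zero_of_tangent {M S W : Set (CSpace n)} (hW : IsOpen W) {F : SmoothFn n}
    (hM : ∀ x ∈ W, (x ∈ M ↔ x.2 = F x.1)) (hSM : S ⊆ M) {z : Fin n → ℂ}
    (hzW : ((z, F z) : CSpace n) ∈ W)
    (hTz : tangentOneZero S (z, F z) = tangentOneZero M (z, F z)) {f : SmoothFn n}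
    (h2 : f ∈ vanishingNear S F z) {a : Fin n → ℂ}
    (ha : ∑ i, starRingEnd ℂ (a i) * wirt (Sum.inr i) F z = 0) :
    ∑ i, a i * wirt (Sum.inl i) f z = 0 ∧
      ∑ i, starRingEnd ℂ (a i) * wirt (Sum.inr i) f z = 0 := by
  have hI : ∀ g : SmoothFn n, dirDeriv (Complex.I • a) g z
      = Complex.I * (∑ i, a i * wirt (Sum.inl i) g z)
        - Complex.I * ∑ i, starRingEnd ℂ (a i) * wirt (Sum.inr i) g z := by
    intro g
    rw [dirDeriv_eq_wirt, Finset.mul_sum, Finset.mul_sum, ← Finset.sum_sub_distrib]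
    refine Finset.sum_congr rfl fun i _ => ?_
    simp only [Pi.smul_apply, smul_eq_mul, map_mul, Complex.conj_I]
    ring
  have h1' : ∀ g : SmoothFn n, dirDeriv a g z = (∑ i, a i * wirt (Sum.inl i) g z)
      + ∑ i, starRingEnd ℂ (a i) * wirt (Sum.inr i) g z := by
    intro g
    rw [dirDeriv_eq_wirt, Finset.sum_add_distrib]
  have hv : ((a, dirDeriv a F z) : CSpace n) ∈ tangentOneZero M (z, F z) := by
    refine ⟨graph_tangent hW hM hzW a, ?_⟩
    have := graph_tangent hW hM hzW (Complex.I • a)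
    rw [hI, ha, mul_zero, sub_zero] at this
    rwa [Prod.smul_mk, h1', ha, add_zero, smul_eq_mul]
  rw [← hTz] at hv
  have e1 := dirDeriv_eq_zero_of_mem_realTangent hW hM hSM hzW h2 hv.1
  have e2 := dirDeriv_eq_zero_of_mem_realTangent hW hM hSM hzW h2 hv.2
  simp only [Prod.smul_mk] at e1 e2
  rw [h1'] at e1
  rw [hI, ← mul_sub] at e2
  have e3 := (mul_eq_zero.1 e2).resolve_left Complex.I_ne_zero
  exact ⟨by linear_combination (e1 + e3) / 2, by linear_combination (e1 - e3) / 2⟩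

/-- The tangent spaces of type `(1,0)` of `M` and of the CR submanifold `S` agree at all points of
`S` near the given one, since both dimensions are constant. -/
lemma tangentOneZero_eventually_eq {M S W : Set (CSpace n)} (hW : IsOpen W) {F : SmoothFn n}
    {z₀ : Fin n → ℂ} (hz₀ : ((z₀, F z₀) : CSpace n) ∈ W)
    (hCR : ∀ᶠ y in 𝓝[M] ((z₀, F z₀) : CSpace n), crDim M y = crDim M (z₀, F z₀)) (hSM : S ⊆ M)
    (hxS : ((z₀, F z₀) : CSpace n) ∈ S) {d : ℕ} (hd : ∀ x ∈ S, crDim S x = d)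
    (hT : tangentOneZero S (z₀, F z₀) = tangentOneZero M (z₀, F z₀)) :
    ∀ᶠ z in 𝓝 z₀, ((z, F z) : CSpace n) ∈ S → ((z, F z) : CSpace n) ∈ W ∧
    tangentOneZero S (z, F z) = tangentOneZero M (z, F z) := by
  have hcont := continuous_graph F
  have h1 := (hcont.tendsto z₀).eventually (eventually_nhdsWithin_iff.1 hCR)
  filter_upwards [h1, (hcont.tendsto z₀).eventually (hW.mem_nhds hz₀)] with z h1 h2 hz
  refine ⟨h2, Submodule.eq_of_le_of_finrank_eq (tangentOneZero_mono hSM _) ?_⟩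
  have e1 : crDim S (z, F z) = crDim S (z₀, F z₀) := by rw [hd _ hz, hd _ hxS]
  have e2 : crDim S (z₀, F z₀) = crDim M (z₀, F z₀) := by rw [crDim, hT, crDim]
  have e3 := h1 (hSM hz)
  exact e1.trans (e2.trans e3.symm)

/-- A submanifold of dimension less than `2n` in the graph has a defining function with nonzero
differential. -/
lemma exists_mem_vanishingNear {S : Set (CSpace n)} {k : ℕ} (hk : k < 2 * n)
    (hsub : IsSmoothSubmanifold k S) {F : SmoothFn n} {z₀ : Fin n → ℂ}
    (hxS : ((z₀, F z₀) : CSpace n) ∈ S) :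
    ∃ ψ ∈ vanishingNear S F z₀, ∃ i, wirt i ψ z₀ ≠ 0 := by
  have hcont := continuous_graph F
  obtain ⟨e, P, hxe, he, hes, hPk, heS⟩ := hsub _ hxS
  -- The differential of `z ↦ e (z, F z)` is injective, so its range is not contained in `P`.
  have hgr : HasFDerivAt (fun z => ((z, F z) : CSpace n))
      ((ContinuousLinearMap.id ℝ (Fin n → ℂ)).prod (fderiv ℝ F z₀)) z₀ :=
    (hasFDerivAt_id z₀).prodMk (SmoothFn.differentiable F z₀).hasFDerivAt
  have hde : HasFDerivAt e (fderiv ℝ e (z₀, F z₀)) (z₀, F z₀) :=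
    ((he.contDiffAt (e.open_source.mem_nhds hxe)).differentiableAt (by simp)).hasFDerivAt
  have hdes : HasFDerivAt e.symm (fderiv ℝ e.symm (e (z₀, F z₀))) (e (z₀, F z₀)) :=
    ((hes.contDiffAt (e.open_target.mem_nhds (e.map_source hxe))).differentiableAt
      (by simp)).hasFDerivAt
  have hinj : ∀ v, fderiv ℝ e (z₀, F z₀) v = 0 → v = 0 := by
    intro v hv
    have h1 := hdes.comp (z₀, F z₀) hde
    have h2 : (e.symm ∘ e) =ᶠ[𝓝 (z₀, F z₀)] id := by
      filter_upwards [e.open_source.mem_nhds hxe] with y hy using e.left_inv hy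
    have h3 := h1.unique ((hasFDerivAt_id _).congr_of_eventuallyEq h2)
    have h4 := congrArg (fun L => L v) h3
    simpa [hv] using h4.symm
  have hcomp := hde.comp z₀ hgr
  set L : (Fin n → ℂ) →L[ℝ] CSpace n := (fderiv ℝ e (z₀, F z₀)).comp
    ((ContinuousLinearMap.id ℝ (Fin n → ℂ)).prod (fderiv ℝ F z₀)) with hL
  have hLinj : Function.Injective L.toLinearMap := by
    refine (injective_iff_map_eq_zero _).2 fun v hv => ?_
    have := hinj _ hv
    simpa using congrArg Prod.fst this
  obtain ⟨v, hv⟩ : ∃ v, L v ∉ P := by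
    by_contra! hall
    have h1 : LinearMap.range L.toLinearMap ≤ P := by
      rintro _ ⟨v, rfl⟩; exact hall v
    have h2 := Submodule.finrank_mono h1
    rw [LinearMap.finrank_range_of_inj hLinj, hPk, Module.finrank_pi_fintype] at h2
    simp [Complex.finrank_real_complex] at h2
    omega
  obtain ⟨φ, hφv, hφP⟩ := P.exists_dual_map_eq_bot_of_notMem hv inferInstance
  have hφ0 : ∀ y ∈ P, φ y = 0 := by
    intro y hy
    have : φ y ∈ P.map φ := Submodule.mem_map_of_mem hy
    rw [hφP] at this
    simpa using this
  let φc : CSpace n →L[ℝ] ℝ := LinearMap.toContinuousLinearMap φ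
  have hφc : ∀ y, φc y = φ y := fun _ => rfl
  obtain ⟨ψ, hψ⟩ := exists_smoothFn_eventuallyEq
    (f := fun z => ((φc (e (z, F z)) : ℝ) : ℂ)) (e.open_source.preimage hcont)
    (z₀ := z₀) hxe (by
      have h1 : ContDiffOn ℝ ∞ (fun z => ((z, F z) : CSpace n))
          ((fun z => ((z, F z) : CSpace n)) ⁻¹' e.source) :=
        (contDiff_id.prodMk (SmoothFn.contDiff F)).contDiffOn
      exact (Complex.ofRealCLM.contDiff.comp φc.contDiff).comp_contDiffOn
        (he.comp h1 fun z hz => hz))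
  refine ⟨ψ, ?_, ?_⟩
  · filter_upwards [hψ, (hcont.tendsto z₀).eventually (e.open_source.mem_nhds hxe)] with z h1 h2 hz
    rw [h1, hφc, hφ0 _ ((heS _ h2).1 hz), Complex.ofReal_zero]
  · by_contra! hall
    have h1 : dirDeriv v ψ z₀ = 0 := by
      rw [dirDeriv_eq_wirt]; simp [hall]
    have h2 : HasFDerivAt (fun z => ((φc (e (z, F z)) : ℝ) : ℂ))
        (Complex.ofRealCLM.comp (φc.comp L)) z₀ :=
      Complex.ofRealCLM.hasFDerivAt.comp z₀ (φc.hasFDerivAt.comp z₀ hcomp)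
    rw [dirDeriv_apply, hψ.fderiv_eq, h2.fderiv] at h1
    have h3 : ((φc (L v) : ℝ) : ℂ) = 0 := h1
    exact hφv (by exact_mod_cast h3)

/-- The trace of non-minimality on the ring of functions of `z`: at `z₀` there is an additive group of
functions vanishing at `z₀`, not all of them critical there, that is stable under the fields of type
`(1,0)` and `(0,1)` tangent to the graph of `F`. These are the fields `∑ Xᵢ ∂ᵢ` annihilating `F̄` and
`∑ Yᵢ ∂̄ᵢ` annihilating `F`. -/
def HasStableFunctions (F : SmoothFn n) (z₀ : Fin n → ℂ) : Prop :=
  ∃ J : AddSubgroup (SmoothFn n), (∀ f ∈ J, f z₀ = 0) ∧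
    (∀ X : Fin n → SmoothFn n, along (dZ n) X (conj F) = 0 →
      ∀ f : SmoothFn n, f ∈ J → along (dZ n) X f ∈ J) ∧
    (∀ Y : Fin n → SmoothFn n, along (dZb n) Y F = 0 →
      ∀ f : SmoothFn n, f ∈ J → along (dZb n) Y f ∈ J) ∧
    ∃ ψ ∈ J, ∃ i, wirt i ψ z₀ ≠ 0

/-- Near a non-minimal point the functions vanishing on the CR submanifold `S` are stable under the
tangential fields of type `(1,0)` and `(0,1)`, and since `dim S < dim M` one of them has nonzero
differential. -/
lemma hasStableFunctions_of_nonminimal {M W : Set (CSpace n)} (hW : IsOpen W) {F : SmoothFn n}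
    (hM : ∀ x ∈ W, (x ∈ M ↔ x.2 = F x.1)) {z₀ : Fin n → ℂ} (hz₀ : ((z₀, F z₀) : CSpace n) ∈ W)
    (h : IsNonminimalCRPoint (2 * n) M (z₀, F z₀)) :
    HasStableFunctions F z₀ := by
  obtain ⟨⟨-, hCR⟩, S, k, hSM, hxS, hk, ⟨hsub, d, hd⟩, hT⟩ := h
  have htan := tangentOneZero_eventually_eq hW hz₀ hCR hSM hxS hd hT
  have hkey : ∀ f ∈ vanishingNear S F z₀, ∀ᶠ z in 𝓝 z₀, ((z, F z) : CSpace n) ∈ S →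
      ∀ a : Fin n → ℂ, ∑ i, starRingEnd ℂ (a i) * wirt (Sum.inr i) F z = 0 →
      ∑ i, a i * wirt (Sum.inl i) f z = 0 ∧
        ∑ i, starRingEnd ℂ (a i) * wirt (Sum.inr i) f z = 0 := by
    intro f hf
    filter_upwards [htan, eventually_eventually_nhds.2 hf] with z h1 h2 hz a ha
    exact wirt_eq_zero_of_tangent hW hM hSM (h1 hz).1 (h1 hz).2 h2 ha
  refine ⟨vanishingNear S F z₀, fun f hf => hf.self_of_nhds hxS, fun X hX f hf => ?_,
    fun Y hY f hf => ?_, exists_mem_vanishingNear hk hsub hxS⟩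
  · filter_upwards [hkey f hf] with z h1 hz
    rw [along_apply, sum_apply]
    refine (h1 hz (fun i => X i z) ?_).1
    have h2 := congrArg (fun g : SmoothFn n => starRingEnd ℂ (g z)) hX
    simp only [along_apply, sum_apply, mul_apply, map_sum, map_mul, zero_apply, map_zero] at h2
    rw [← h2]
    refine Finset.sum_congr rfl fun i _ => ?_
    rw [← conj_apply (wirt (Sum.inl i) (conj F)), conj_wirt, conj_conj]
    rfl
  · filter_upwards [hkey f hf] with z h1 hz
    rw [along_apply, sum_apply]
    have h2 := congrArg (fun g : SmoothFn n => g z) hY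
    simp only [along_apply, sum_apply, mul_apply, zero_apply] at h2
    have := (h1 hz (fun i => starRingEnd ℂ (Y i z)) (by simpa using h2)).2
    simpa using this

end Geometry

/-! ### The Levi determinants and their leading parts -/

section Pointwise

variable {A : Type*} [CommRing A] [Algebra ℂ A]

lemma hess_add (d d' : Fin n → Derivation ℂ A A) (f g : A) (X Y : Fin n → A) :
    hess d d' (f + g) X Y = hess d d' f X Y + hess d d' g X Y := by
  simp only [hess, map_add, mul_add, Finset.sum_add_distrib]

lemma third_add (d d' : Fin n → Derivation ℂ A A) (f g : A) (X Y Z : Fin n → A) :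
    third d d' (f + g) X Y Z = third d d' f X Y Z + third d d' g X Y Z := by
  simp only [third, hess_add, map_add]
  ring

/-- At a point where some group `J` of functions is stable under the tangential fields, as in
`HasStableFunctions`, the vectors formed by the Hessians and third-order expressions of `G` and of
`G'` in tangential directions are proportional. -/
lemma levi_proportional {d d' : Fin n → Derivation ℂ A A}
    (hdd : ∀ i j f, d i (d j f) = d j (d i f)) (hdd' : ∀ i j f, d i (d' j f) = d' j (d i f))
    {J : AddSubgroup A} {e : A →ₐ[ℂ] ℂ} (he : ∀ f ∈ J, e f = 0) {ψ F F' G G' μ μ' : A}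
    (hψ : ψ ∈ J) (hψ0 : (∃ i, e (d i ψ) ≠ 0) ∨ ∃ i, e (d' i ψ) ≠ 0)
    (hG : ∀ i, d' i G = μ * d' i F) (hG' : ∀ i, d i G' = μ' * d i F')
    (hJ : ∀ X : Fin n → A, along d X F' = 0 → ∀ f ∈ J, along d X f ∈ J)
    (hJ' : ∀ Y : Fin n → A, along d' Y F = 0 → ∀ f ∈ J, along d' Y f ∈ J) (a b k l k' l' : Fin n) :
    e (hess d d' G' (rot (d · G') a b) (rot (d' · G) a b)
        * hess d d' G (rot (d · G') k l) (rot (d' · G) k' l')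
      - hess d d' G' (rot (d · G') k l) (rot (d' · G) k' l')
        * hess d d' G (rot (d · G') a b) (rot (d' · G) a b)) = 0 ∧
    e (hess d d' G' (rot (d · G') a b) (rot (d' · G) a b)
        * third d d' G (rot (d · G') a b) (rot (d' · G) a b) (rot (d · G') k l)
      - third d d' G' (rot (d · G') a b) (rot (d' · G) a b) (rot (d · G') k l)
        * hess d d' G (rot (d · G') a b) (rot (d' · G) a b)) = 0 := by
  by_cases h1 : ∃ i, e (d i G') ≠ 0
  swap
  · push Not at h1
    simp [hess_rot, h1]
  by_cases h2 : ∃ i, e (d' i G) ≠ 0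
  swap
  · push Not at h2
    simp [hess_rot, h2]
  have hX : ∀ k l, along d (rot (d · G') k l) G' = 0 := fun k l => by rw [along_rot]; ring
  have hY : ∀ k l, along d' (rot (d' · G) k l) G = 0 := fun k l => by rw [along_rot]; ring
  have hXJ : ∀ k l, ∀ f ∈ J, along d (rot (d · G') k l) f ∈ J := fun k l =>
    hJ _ (by rw [along_rot, hG', hG']; ring)
  have hYJ : ∀ k l, ∀ f ∈ J, along d' (rot (d' · G) k l) f ∈ J := fun k l =>
    hJ' _ (by rw [along_rot, hG, hG]; ring)
  obtain ⟨i, hi⟩ := h1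
  obtain ⟨j, hj⟩ := h2
  obtain ⟨α, hα⟩ : ∃ α, ∀ l, e (d l ψ) = α * e (d l G') := by
    refine ⟨e (d i ψ) / e (d i G'), fun l => ?_⟩
    have := he _ (hXJ i l ψ hψ)
    rw [along_rot, map_sub, map_mul, map_mul] at this
    field_simp
    linear_combination this
  obtain ⟨β, hβ⟩ : ∃ β, ∀ l, e (d' l ψ) = β * e (d' l G) := by
    refine ⟨e (d' j ψ) / e (d' j G), fun l => ?_⟩
    have := he _ (hYJ j l ψ hψ)
    rw [along_rot, map_sub, map_mul, map_mul] at this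
    field_simp
    linear_combination this
  have hαβ : α ≠ 0 ∨ β ≠ 0 := by
    rcases hψ0 with ⟨i, hi⟩ | ⟨i, hi⟩
    · left; rintro rfl; simp [hα] at hi
    · right; rintro rfl; simp [hβ] at hi
  have hdet : ∀ u v u' v' : ℂ, α * u = β * v → α * u' = β * v' → u * v' - u' * v = 0 := by
    intro u v u' v' h h'
    rcases hαβ with h0 | h0
    · exact (mul_eq_zero.1 (by linear_combination v' * h - v * h' :
        α * (u * v' - u' * v) = 0)).resolve_left h0
    · exact (mul_eq_zero.1 (by linear_combination u' * h - u * h' :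
        β * (u * v' - u' * v) = 0)).resolve_left h0
  have r1 := bracket_relations hdd hdd' he hψ hα hβ (hX a b) (hY a b) (hX k l) (hXJ a b) (hYJ a b)
    (hXJ k l)
  have r2 := bracket_relations hdd hdd' he hψ hα hβ (hX k l) (hY k' l') (hX k l) (hXJ k l)
    (hYJ k' l') (hXJ k l)
  simp only [map_sub, map_mul]
  exact ⟨hdet _ _ _ _ r1.1 r2.1, hdet _ _ _ _ r1.1 r1.2⟩

end Pointwise

section LeadingParts

variable {s t : Fin n → Fin n ⊕ Fin n} {x y z : Fin n → Poly n} {X Y Z : Fin n → SmoothFn n}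
  {f : SmoothFn n} {p : Poly n} {m : ℕ}

lemma SmoothFn.Lead.rot (hX : ∀ i, Lead m (X i) (x i)) (k l j : Fin n) :
    Lead m (rot X k l j) (rot x k l j) := by
  unfold Flattening.rot
  refine Lead.sub ?_ ?_ <;> split_ifs
  exacts [hX _, Lead.zero _, hX _, Lead.zero _]

lemma SmoothFn.Lead.along (hX : ∀ i, Lead 1 (X i) (x i)) (hf : Lead (m + 1) f p) :
    Lead (m + 1) (along (fun i => SmoothFn.wirt (s i)) X f) (along (fun i => pderiv (s i)) x p) := by
  rw [along_apply, along_apply]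
  refine Lead.sum _ fun i _ => ?_
  rw [add_comm]
  exact (hX i).mul (hf.wirt _)

lemma SmoothFn.Lead.hess (hX : ∀ i, Lead 1 (X i) (x i)) (hY : ∀ i, Lead 1 (Y i) (y i))
    (hf : Lead (m + 2) f p) :
    Lead (m + 2) (hess (fun i => SmoothFn.wirt (s i)) (fun i => SmoothFn.wirt (t i)) f X Y)
      (hess (fun i => pderiv (s i)) (fun i => pderiv (t i)) p x y) := by
  refine Lead.sum _ fun i _ => Lead.sum _ fun j _ => ?_
  rw [add_comm]
  exact ((hX i).mul (hY j)).mul ((hf.wirt _).wirt _)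

lemma SmoothFn.Lead.third (hX : ∀ i, Lead 1 (X i) (x i)) (hY : ∀ i, Lead 1 (Y i) (y i))
    (hZ : ∀ i, Lead 1 (Z i) (z i)) (hf : Lead (m + 2) f p) :
    Lead (m + 2) (third (fun i => SmoothFn.wirt (s i)) (fun i => SmoothFn.wirt (t i)) f X Y Z)
      (third (fun i => pderiv (s i)) (fun i => pderiv (t i)) p x y z) :=
  (Lead.along hZ (Lead.hess hX hY hf)).add (Lead.hess hZ (fun j => Lead.along hX (hY j)) hf)

end LeadingParts

lemma SmoothFn.Lead.mul_eq_mul {i j : ℕ} {u u' v v' : SmoothFn n} {p p' r r' : Poly n}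
    (hu : Lead i u p) (hu' : Lead i u' p') (hv : Lead j v r) (hv' : Lead j v' r')
    {O : Set (Fin n → ℂ)} (hO : IsOpen O) (h0 : 0 ∈ closure O)
    (h : ∀ z ∈ O, (u * (u' + v') - u' * (u + v)) z = 0) : p * r' = p' * r := by
  have h1 := (hu.mul hv').sub (hu'.mul hv)
  rw [show u * v' - u' * v = u * (u' + v') - u' * (u + v) by ring] at h1
  exact sub_eq_zero.1 (h1.eq_zero (VanishOrd.of_eqOn_open hO h0 h _))

/-- If the points over an open set adherent to the origin are non-minimal, then the leading part of
`G - Ḡ` solves the linearized flattening system. Here `G` is the defining function in some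
holomorphic coordinates, so that `∂̄G` is a multiple of `∂̄F`. -/
lemma isFlatSol_of_nonminimal (hn : 2 ≤ n) {lam : Fin n → ℝ} (hlam : ∀ i, 0 ≤ lam i) {a b : Fin n}
    (hab : a ≠ b) (ha : lam a ≠ 1 / 2) {F G μ : SmoothFn n}
    (hG : ∀ i, dZb n i G = μ * dZb n i F) (hq : Lead 2 G (quad lam)) {O : Set (Fin n → ℂ)}
    (hO : IsOpen O) (h0 : 0 ∈ closure O)
    (hJ : ∀ z ∈ O, HasStableFunctions F z)
    {m : ℕ} {e : Poly n} (he : Lead (m + 3) (G - conj G) e) :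
    ∃ κ κ', IsFlatSol dz dzb (quad lam) e κ κ' := by
  have hq' : Lead 2 (conj G) (quad lam) :=
    hq.of_sub (by simpa using (he.vanishOrd.mono (by omega : 3 ≤ m + 3)).neg)
  have hG' : ∀ i, dZ n i (conj G) = conj μ * dZ n i (conj F) := by
    intro i
    have h1 := conj_wirt (Sum.inr i) G
    have h2 := conj_wirt (Sum.inr i) F
    rw [hG, map_mul, h2] at h1
    exact h1.symm
  have hdd : ∀ i j f, dZ n i (dZ n j f) = dZ n j (dZ n i f) := fun i j f => wirt_comm _ _ f
  have hdd' : ∀ i j f, dZ n i (dZb n j f) = dZb n j (dZ n i f) := fun i j f => wirt_comm _ _ f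
  have hd'd : ∀ i j f, dZb n i (dZ n j f) = dZ n j (dZb n i f) := fun i j f => wirt_comm _ _ f
  have hd'd' : ∀ i j f, dZb n i (dZb n j f) = dZb n j (dZb n i f) := fun i j f => wirt_comm _ _ f
  -- the coefficients of the tangential fields, with their leading parts
  obtain ⟨X, hX⟩ : ∃ X : Fin n → Fin n → Fin n → SmoothFn n,
    ∀ k l, X k l = rot (dZ n · (conj G)) k l := ⟨_, fun _ _ => rfl⟩
  obtain ⟨Y, hY⟩ : ∃ Y : Fin n → Fin n → Fin n → SmoothFn n,
    ∀ k l, Y k l = rot (dZb n · G) k l := ⟨_, fun _ _ => rfl⟩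
  have hL : ∀ k l i, Lead 1 (X k l i) (rot (dz · (quad lam)) k l i) := fun k l => by
    rw [hX]; exact Lead.rot (fun i => hq'.wirt _) k l
  have hL' : ∀ k l i, Lead 1 (Y k l i) (rot (dzb · (quad lam)) k l i) := fun k l => by
    rw [hY]; exact Lead.rot (fun i => hq.wirt _) k l
  have h1 : ∀ k l k' l', ∀ z ∈ O, (hess (dZ n) (dZb n) (conj G) (X a b) (Y a b)
        * hess (dZ n) (dZb n) G (X k l) (Y k' l')
      - hess (dZ n) (dZb n) (conj G) (X k l) (Y k' l')
        * hess (dZ n) (dZb n) G (X a b) (Y a b)) z = 0 := by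
    intro k l k' l' z hz
    obtain ⟨J, hJ0, hJ1, hJ2, ψ, hψ, hψ0⟩ := hJ z hz
    simp only [hX, hY]
    exact (levi_proportional (e := evalAt z) hdd hdd' hJ0 hψ (Sum.exists.1 hψ0) hG hG' hJ1 hJ2
      a b k l k' l').1
  have h2 : ∀ k l, ∀ z ∈ O, (hess (dZ n) (dZb n) (conj G) (X a b) (Y a b)
        * third (dZ n) (dZb n) G (X a b) (Y a b) (X k l)
      - third (dZ n) (dZb n) (conj G) (X a b) (Y a b) (X k l)
        * hess (dZ n) (dZb n) G (X a b) (Y a b)) z = 0 := by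
    intro k l z hz
    obtain ⟨J, hJ0, hJ1, hJ2, ψ, hψ, hψ0⟩ := hJ z hz
    simp only [hX, hY]
    exact (levi_proportional (e := evalAt z) hdd hdd' hJ0 hψ (Sum.exists.1 hψ0) hG hG' hJ1 hJ2
      a b k l k l).2
  have h3 : ∀ k l, ∀ z ∈ O, (hess (dZb n) (dZ n) G (Y a b) (X a b)
        * third (dZb n) (dZ n) (conj G) (Y a b) (X a b) (Y k l)
      - third (dZb n) (dZ n) G (Y a b) (X a b) (Y k l)
        * hess (dZb n) (dZ n) (conj G) (Y a b) (X a b)) z = 0 := by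
    intro k l z hz
    obtain ⟨J, hJ0, hJ1, hJ2, ψ, hψ, hψ0⟩ := hJ z hz
    simp only [hX, hY]
    exact (levi_proportional (e := evalAt z) hd'd' hd'd hJ0 hψ (Sum.exists.1 hψ0).symm hG' hG hJ2 hJ1
      a b k l k l).2
  have hadd : G = conj G + (G - conj G) := by ring
  generalize G - conj G = δ at hadd he
  have H : ∀ {f : SmoothFn n} {p : Poly n} {m : ℕ}, Lead (m + 2) f p → ∀ k l k' l',
      Lead (m + 2) (hess (dZ n) (dZb n) f (X k l) (Y k' l'))
        (hess dz dzb p (rot (dz · (quad lam)) k l) (rot (dzb · (quad lam)) k' l')) :=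
    fun hf k l k' l' => Lead.hess (s := Sum.inl) (t := Sum.inr) (hL k l) (hL' k' l') hf
  have T : ∀ {f : SmoothFn n} {p : Poly n} {m : ℕ}, Lead (m + 2) f p → ∀ k l,
      Lead (m + 2) (third (dZ n) (dZb n) f (X a b) (Y a b) (X k l))
        (third dz dzb p (rot (dz · (quad lam)) a b) (rot (dzb · (quad lam)) a b)
          (rot (dz · (quad lam)) k l)) :=
    fun hf k l => Lead.third (s := Sum.inl) (t := Sum.inr) (hL a b) (hL' a b) (hL k l) hf
  have H' : ∀ {f : SmoothFn n} {p : Poly n} {m : ℕ}, Lead (m + 2) f p →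
      Lead (m + 2) (hess (dZb n) (dZ n) f (Y a b) (X a b)) (hessRot lam a b p) := by
    intro f p m hf
    rw [hess_swap hdd']
    exact H hf a b a b
  have T' : ∀ {f : SmoothFn n} {p : Poly n} {m : ℕ}, Lead (m + 2) f p → ∀ k l,
      Lead (m + 2) (third (dZb n) (dZ n) f (Y a b) (X a b) (Y k l))
        (third dzb dz p (rot (dzb · (quad lam)) a b) (rot (dz · (quad lam)) a b)
          (rot (dzb · (quad lam)) k l)) :=
    fun hf k l => Lead.third (s := Sum.inr) (t := Sum.inl) (hL' a b) (hL a b) (hL' k l) hf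
  refine exists_isFlatSol hn hlam hab ha (fun k l k' l' => ?_) (fun k l => ?_) (fun k l => ?_)
  · rw [← hessRot_quad hab, mul_comm (hessRot lam a b e)]
    refine Lead.mul_eq_mul (H hq' a b a b) (H hq' k l k' l') (H he a b a b) (H he k l k' l') hO h0
      fun z hz => ?_
    rw [← hess_add, ← hess_add, ← hadd]
    exact h1 k l k' l' z hz
  · rw [← hessRot_quad hab, mul_comm (hessRot lam a b e)]
    refine Lead.mul_eq_mul (H hq' a b a b) (T hq' k l) (H he a b a b) (T he k l) hO h0
      fun z hz => ?_
    rw [← hess_add, ← third_add, ← hadd]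
    exact h2 k l z hz
  · rw [← hessRot_quad hab, mul_comm (hessRot lam a b e)]
    refine Lead.mul_eq_mul (H' hq') (T' hq' k l) (H' he) (T' he k l) hO h0 fun z hz => ?_
    rw [← hess_add, ← third_add, ← hadd]
    have h := h3 k l z hz
    simp only [sub_apply, mul_apply] at h ⊢
    linear_combination -h

/-! ### Corrections by holomorphic functions -/

section Conjugation

/-- Conjugation of polynomials in `z, z̄`: the coefficients are conjugated and `zᵢ`, `z̄ᵢ` exchanged. -/
noncomputable def conjPoly : Poly n →+* Poly n :=
  (rename Sum.swap : Poly n →ₐ[ℂ] Poly n).toRingHom.comp (map (starRingEnd ℂ))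

lemma conjPoly_apply (p : Poly n) : conjPoly p = rename Sum.swap (map (starRingEnd ℂ) p) := rfl

lemma ev_conjPoly (p : Poly n) : ev (conjPoly p) = conj (ev p) := by
  induction p using MvPolynomial.induction_on with
  | C c => ext z; simp [conjPoly_apply]
  | add p q hp hq => simp only [map_add, hp, hq]
  | mul_X p i hp =>
    rw [map_mul, map_mul, map_mul, map_mul, hp, ev_X, conj_coord]
    simp [conjPoly_apply]

lemma conjPoly_conjPoly (p : Poly n) : conjPoly (conjPoly p) = p := by
  rw [conjPoly_apply, conjPoly_apply, map_rename, rename_rename, MvPolynomial.map_map,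
    show (Sum.swap ∘ Sum.swap : Fin n ⊕ Fin n → _) = id from Sum.swap_swap_eq, rename_id,
    show (starRingEnd ℂ).comp (starRingEnd ℂ) = RingHom.id ℂ from RingHom.ext Complex.conj_conj,
    MvPolynomial.map_id]
  rfl

lemma conjPoly_rename_inr (c : MvPolynomial (Fin n) ℂ) :
    conjPoly (rename Sum.inr c) = rename Sum.inl (map (starRingEnd ℂ) c) := by
  rw [conjPoly_apply, map_rename, rename_rename]
  rfl

lemma conjPoly_quad (lam : Fin n → ℝ) : conjPoly (quad lam) = quad lam := by
  rw [conjPoly_apply, quad]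
  simp only [map_sum, map_add, map_mul, map_pow, map_X, map_C, rename_X, rename_C,
    Complex.conj_ofReal, Sum.swap_inl, Sum.swap_inr]
  exact Finset.sum_congr rfl fun i _ => by ring

lemma SmoothFn.Lead.conj {k : ℕ} {f : SmoothFn n} {p : Poly n} (h : Lead k f p) :
    Lead k (SmoothFn.conj f) (conjPoly p) :=
  ⟨(h.hom.map _).rename_isHomogeneous, by
    rw [ev_conjPoly, ← map_sub]
    exact h.rem.conj⟩

lemma SmoothFn.Lead.pow {k : ℕ} {f : SmoothFn n} {p : Poly n} (h : Lead k f p) (j : ℕ) :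
    Lead (k * j) (f ^ j) (p ^ j) := by
  induction j with
  | zero => simpa using Lead.ev (n := n) (isHomogeneous_one (Fin n ⊕ Fin n) ℂ)
  | succ j ih => rw [pow_succ, pow_succ, mul_add, mul_one]; exact ih.mul h

end Conjugation

/-- `h` is an admissible holomorphic change of the last coordinate, and `g` is its restriction to the
graph of `F`. -/
structure IsCorrection (F : SmoothFn n) (h : CSpace n → ℂ) (g : SmoothFn n) : Prop where
  contDiff : ContDiff ℂ 1 h
  isLittleO : h =o[𝓝 0] fun x => (∑ i, ‖x.1 i‖ ^ 2) + ‖x.2‖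
  apply_graph : ∀ z, g z = h (z, F z)
  dbar : ∃ μ, ∀ i, dZb n i g = μ * dZb n i F

namespace IsCorrection

variable {F : SmoothFn n}

lemma zero : IsCorrection F (fun _ => 0) 0 :=
  ⟨contDiff_const, isLittleO_zero _ _, fun _ => rfl, 0, fun i => by simp⟩

lemma add {h₁ h₂ : CSpace n → ℂ} {g₁ g₂ : SmoothFn n} (H₁ : IsCorrection F h₁ g₁)
    (H₂ : IsCorrection F h₂ g₂) : IsCorrection F (fun x => h₁ x + h₂ x) (g₁ + g₂) := by
  refine ⟨H₁.contDiff.add H₂.contDiff, H₁.isLittleO.add H₂.isLittleO, fun z => ?_, ?_⟩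
  · rw [add_apply, H₁.apply_graph, H₂.apply_graph]
  · obtain ⟨μ₁, h1⟩ := H₁.dbar
    obtain ⟨μ₂, h2⟩ := H₂.dbar
    exact ⟨μ₁ + μ₂, fun i => by rw [map_add, h1, h2]; ring⟩

lemma sum {ι : Type*} (s : Finset ι) {h : ι → CSpace n → ℂ} {g : ι → SmoothFn n}
    (H : ∀ j ∈ s, IsCorrection F (h j) (g j)) :
    IsCorrection F (fun x => ∑ j ∈ s, h j x) (∑ j ∈ s, g j) := by
  classical
  induction s using Finset.induction_on with
  | empty => simpa using zero
  | insert j s hj ih =>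
    simp only [Finset.sum_insert hj]
    exact (H j (by simp)).add (ih fun i hi => H i (by simp [hi]))

/-- The monomials of weight at least three, where `z` has weight one and `w` has weight two. -/
lemma monomial {c : MvPolynomial (Fin n) ℂ} {k j : ℕ} (hc : c.IsHomogeneous k) (hkj : 3 ≤ k + 2 * j) :
    IsCorrection F (fun x => ev (rename Sum.inl c) (x.1) * x.2 ^ j) (ev (rename Sum.inl c) * F ^ j) := by
  have hev : ∀ z : Fin n → ℂ, ev (rename Sum.inl c) z = aeval z c := by
    intro z
    rw [← evalAt_apply, ev, aeval_rename, ← AlgHom.comp_apply, comp_aeval]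
    rfl
  refine ⟨?_, ?_, fun z => by simp, (j : SmoothFn n) * (ev (rename Sum.inl c) * F ^ (j - 1)),
    fun i => ?_⟩
  · simp only [hev, aeval_def, eval₂_eq]
    refine ContDiff.mul (ContDiff.sum fun d _ => contDiff_const.mul (contDiff_prod fun i _ => ?_)) ?_
    · exact ((contDiff_apply ℂ ℂ i).comp contDiff_fst).pow _
    · exact contDiff_snd.pow _
  · have h1 : (fun x : CSpace n => ev (rename Sum.inl c) x.1) =O[𝓝 0] fun x => ‖x.1‖ ^ k :=
      (VanishOrd.ev (hc.rename_isHomogeneous (f := Sum.inl))).isBigO.comp_tendsto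
        (continuous_fst.tendsto (0 : CSpace n))
    have h2 : (fun x : CSpace n => x.2 ^ j) =O[𝓝 0] fun x => ‖x.2‖ ^ j :=
      (isBigO_refl _ _).norm_right.congr_right fun x => norm_pow _ _
    have hz : (fun x : CSpace n => ‖x.1‖ ^ 2) =O[𝓝 0] fun x => (∑ i, ‖x.1 i‖ ^ 2) + ‖x.2‖ := by
      refine IsBigO.of_bound 1 (Eventually.of_forall fun x => ?_)
      have hs : 0 ≤ ∑ i, ‖x.1 i‖ ^ 2 := Finset.sum_nonneg fun i _ => by positivity
      have hn : ‖x.1‖ ≤ √(∑ i, ‖x.1 i‖ ^ 2) := by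
        refine (pi_norm_le_iff_of_nonneg (Real.sqrt_nonneg _)).2 fun i => ?_
        refine Real.le_sqrt_of_sq_le ?_
        exact Finset.single_le_sum (f := fun i => ‖x.1 i‖ ^ 2) (fun i _ => by positivity)
          (Finset.mem_univ i)
      have hn2 := pow_le_pow_left₀ (norm_nonneg _) hn 2
      rw [Real.sq_sqrt hs] at hn2
      rw [norm_pow, norm_norm, one_mul, Real.norm_of_nonneg (by positivity)]
      linarith [norm_nonneg x.2]
    have hw : (fun x : CSpace n => ‖x.2‖) =O[𝓝 0] fun x => (∑ i, ‖x.1 i‖ ^ 2) + ‖x.2‖ := by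
      refine IsBigO.of_bound 1 (Eventually.of_forall fun x => ?_)
      have hs : 0 ≤ ∑ i, ‖x.1 i‖ ^ 2 := Finset.sum_nonneg fun i _ => by positivity
      rw [norm_norm, one_mul, Real.norm_of_nonneg (by positivity)]
      linarith
    have hsmall : ∀ k j : ℕ, k + j ≠ 0 →
        (fun x : CSpace n => ‖x.1‖ ^ k * ‖x.2‖ ^ j) =o[𝓝 0] fun _ => (1 : ℝ) := by
      intro k j hkj
      rw [isLittleO_one_iff]
      have hc : Continuous fun x : CSpace n => ‖x.1‖ ^ k * ‖x.2‖ ^ j := by fun_prop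
      have := hc.tendsto 0
      have h0 : ‖(0 : CSpace n).1‖ ^ k * ‖(0 : CSpace n).2‖ ^ j = 0 := by
        rw [Prod.fst_zero, Prod.snd_zero, norm_zero, norm_zero, ← pow_add, zero_pow hkj]
      rwa [h0] at this
    refine (h1.mul h2).trans_isLittleO ?_
    rcases j with _ | j
    · have := hz.mul_isLittleO (hsmall (k - 2) 0 (by omega))
      simp only [mul_one] at this
      refine this.congr_left fun x => ?_
      rw [← mul_assoc, ← pow_add, show 2 + (k - 2) = k by omega]
    · have := hw.mul_isLittleO (hsmall k j (by omega))
      simp only [mul_one] at this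
      refine this.congr_left fun x => ?_
      ring
  · have h0 : dZb n i (ev (rename Sum.inl c)) = 0 := by
      rw [wirt_ev, dzb_rename_inl, map_zero]
    rw [Derivation.leibniz, h0, Derivation.leibniz_pow]
    simp only [smul_eq_mul, nsmul_eq_mul, mul_zero, add_zero]
    ring

end IsCorrection

/-- A leading part of `G - Ḡ` that solves the linearized flattening system is removed by a
correction `g`, up to terms of higher order. -/
lemma exists_correction (hn : 2 ≤ n) {lam : Fin n → ℝ} {a b : Fin n} (hab : a ≠ b)
    (hP : leviPoly lam a b ≠ 0) {F δ : SmoothFn n} (hF : Lead 2 F (quad lam)) {m : ℕ} (hm : 3 ≤ m)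
    {e : Poly n} (he : Lead m δ e) (hδ : conj δ = -δ)
    (hsol : ∃ κ κ', IsFlatSol dz dzb (quad lam) e κ κ') :
    ∃ h g, IsCorrection F h g ∧ VanishOrd m g ∧ VanishOrd (m + 1) (δ + (g - conj g)) := by
  obtain ⟨κ, κ', hκ⟩ := hsol
  obtain ⟨c, d, hcd, hsum⟩ := IsFlatSol.exists_decomposition hn hab hP he.hom hκ
  have hconj : conjPoly e = -e := by
    have h1 := he.conj.add he
    rw [hδ, neg_add_cancel] at h1
    exact eq_neg_of_add_eq_zero_left (h1.eq_zero (VanishOrd.zero _))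
  set B : ℕ → MvPolynomial (Fin n) ℂ := fun j => C (-1 / 2) * (c j - map (starRingEnd ℂ) (d j))
    with hB
  have hj : ∀ j ∈ Finset.range (m / 2 + 1), 2 * j ≤ m := fun j hj => by
    have := Finset.mem_range.1 hj; omega
  have hBh : ∀ j, 2 * j ≤ m → (B j).IsHomogeneous (m - 2 * j) := fun j hj =>
    IsHomogeneous.C_mul ((hcd j hj).1.sub ((hcd j hj).2.map _)) _
  have hcorr : IsCorrection F _ (∑ j ∈ Finset.range (m / 2 + 1), ev (rename Sum.inl (B j)) * F ^ j) :=
    IsCorrection.sum _ fun j h => IsCorrection.monomial (hBh j (hj j h)) (by have := hj j h; omega)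
  set P : Poly n := ∑ j ∈ Finset.range (m / 2 + 1), rename Sum.inl (B j) * quad lam ^ j with hPd
  have hlead : Lead m (∑ j ∈ Finset.range (m / 2 + 1), ev (rename Sum.inl (B j)) * F ^ j) P := by
    refine Lead.sum _ fun j h => ?_
    have := (Lead.ev ((hBh j (hj j h)).rename_isHomogeneous (f := Sum.inl))).mul (hF.pow j)
    rwa [Nat.sub_add_cancel (hj j h)] at this
  refine ⟨_, _, hcorr, hlead.vanishOrd, ?_⟩
  have hz : e + (P - conjPoly P) = 0 := by
    have h2 : e + conjPoly e = 0 := by rw [hconj, add_neg_cancel]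
    set A := ∑ j ∈ Finset.range (m / 2 + 1), rename Sum.inl (c j) * quad lam ^ j with hA
    set D := ∑ j ∈ Finset.range (m / 2 + 1), rename Sum.inr (d j) * quad lam ^ j with hD
    have heAD : e = A + D := by
      rw [hsum, hA, hD, ← Finset.sum_add_distrib]
      exact Finset.sum_congr rfl fun j _ => by ring
    have hPAD : P = C (-1 / 2) * (A - conjPoly D) := by
      rw [hPd, hA, hD, map_sum, ← Finset.sum_sub_distrib, Finset.mul_sum]
      refine Finset.sum_congr rfl fun j _ => ?_
      rw [map_mul conjPoly, map_pow conjPoly, conjPoly_quad, conjPoly_rename_inr, hB]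
      simp only [map_mul, map_sub, rename_C]
      ring
    have hcC : conjPoly (C (-1 / 2) : Poly n) = C (-1 / 2) := by
      have h2 : starRingEnd ℂ 2 = 2 := Complex.conj_ofNat 2
      simp [conjPoly_apply, h2]
    have hhalf : (2 : Poly n) * C (-1 / 2) = -1 := by
      rw [two_mul_C, ← C_1, ← C_neg]; norm_num
    rw [hPAD, map_mul, map_sub, conjPoly_conjPoly, hcC]
    rw [heAD, map_add] at h2
    rw [heAD]
    have h3 : (2 : Poly n) * (A + D + (C (-1 / 2) * (A - conjPoly D)
        - C (-1 / 2) * (conjPoly A - D))) = 0 := by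
      linear_combination h2 + (A - conjPoly D - conjPoly A + D) * hhalf
    exact (mul_eq_zero.1 h3).resolve_left two_ne_zero
  have h := he.add (hlead.sub hlead.conj)
  rw [hz] at h
  simpa using h.rem

/-- Formal flattening to any finite order: successive corrections remove the leading parts of the
imaginary part one after the other. -/
lemma exists_flattening_correction (hn : 2 ≤ n) {lam : Fin n → ℝ} (hlam : ∀ i, 0 ≤ lam i)
    {a b : Fin n} (hab : a ≠ b) (ha : lam a ≠ 1 / 2) {F : SmoothFn n}
    (hF : VanishOrd 3 (F - ev (quad lam))) {O : Set (Fin n → ℂ)}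
    (hO : IsOpen O) (h0 : 0 ∈ closure O)
    (hJ : ∀ z ∈ O, HasStableFunctions F z) (m : ℕ) :
    ∃ h g, IsCorrection F h g ∧ VanishOrd 3 g ∧ VanishOrd (m + 3) ((F + g) - conj (F + g)) := by
  have hFq : Lead 2 F (quad lam) := ⟨quad_isHomogeneous lam, hF⟩
  induction m with
  | zero =>
    refine ⟨_, _, IsCorrection.zero, VanishOrd.zero _, ?_⟩
    have h1 := hF.sub hF.conj
    rw [map_sub, ← ev_conjPoly, conjPoly_quad] at h1
    simpa using h1
  | succ m ih =>
    obtain ⟨h, g, hg, hg3, hm⟩ := ih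
    obtain ⟨e, he⟩ := hm.exists_lead
    obtain ⟨μ, hμ⟩ := hg.dbar
    have hG : ∀ i, dZb n i (F + g) = (1 + μ) * dZb n i F := fun i => by rw [map_add, hμ]; ring
    have hsol := isFlatSol_of_nonminimal hn hlam hab ha hG (hFq.of_sub (by simpa using hg3)) hO h0 hJ
      he
    obtain ⟨h', g', hg', hgm, hm'⟩ := exists_correction hn hab (leviPoly_prime hab hlam ha).ne_zero
      hFq (by omega : 3 ≤ m + 3) he (by rw [map_sub, conj_conj]; ring) hsol
    refine ⟨_, _, hg.add hg', hg3.add (hgm.mono (by omega)), ?_⟩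
    rw [show F + (g + g') - conj (F + (g + g')) = F + g - conj (F + g) + (g' - conj g') by
      simp only [map_add]; ring, add_right_comm]
    exact hm'

/-! ### The change of coordinates -/

lemma isBigO_norm_weight :
    (fun x : CSpace n => (∑ i, ‖x.1 i‖ ^ 2) + ‖x.2‖) =O[𝓝 0] fun x => x := by
  have h2 : (fun x : CSpace n => ‖x.2‖) =O[𝓝 0] fun x => x :=
    IsBigO.of_bound 1 (Eventually.of_forall fun x => by simpa using norm_snd_le x)
  refine IsBigO.add (IsBigO.fun_sum fun i _ => ?_) h2
  refine IsBigO.of_bound 1 ?_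
  filter_upwards [Metric.ball_mem_nhds (0 : CSpace n) one_pos] with x hx
  have h1 : ‖x.1 i‖ ≤ ‖x‖ := (norm_le_pi_norm x.1 i).trans (norm_fst_le x)
  have h3 : ‖x‖ < 1 := mem_ball_zero_iff.1 hx
  rw [norm_pow, norm_norm, one_mul]
  nlinarith [norm_nonneg (x.1 i)]

/-- A holomorphic function without terms of weight less than three defines a special change of
coordinates, by the inverse function theorem. -/
lemma exists_isSpecialTransform {h : CSpace n → ℂ} (hh : ContDiff ℂ 1 h)
    (ho : h =o[𝓝 0] fun x => (∑ i, ‖x.1 i‖ ^ 2) + ‖x.2‖) :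
    ∃ Φ : OpenPartialHomeomorph (CSpace n) (CSpace n), IsSpecialTransform Φ ∧
      ∀ x, Φ x = (x.1, x.2 + h x) := by
  have hx := ho.trans_isBigO isBigO_norm_weight
  have h0 : h 0 = 0 := by
    obtain ⟨c, hc⟩ := hx.isBigO.bound
    simpa using hc.self_of_nhds
  have hd : HasFDerivAt h (0 : CSpace n →L[ℂ] ℂ) 0 := by
    refine HasFDerivAt.of_isLittleO ?_
    simpa [h0] using hx
  let f : CSpace n → CSpace n := fun x => (x.1, x.2 + h x)
  have hf : ContDiff ℂ 1 f := contDiff_fst.prodMk (contDiff_snd.add hh)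
  have hf' : HasFDerivAt f ((ContinuousLinearEquiv.refl ℂ (CSpace n) : CSpace n ≃L[ℂ] CSpace n) :
      CSpace n →L[ℂ] CSpace n) 0 := by
    have := (hasFDerivAt_fst (𝕜 := ℂ) (p := (0 : CSpace n))).prodMk
      ((hasFDerivAt_snd (𝕜 := ℂ) (p := (0 : CSpace n))).add hd)
    refine this.congr_fderiv ?_
    ext <;> simp
  have hf0 : f 0 = 0 := by simp [f, h0]
  let e := hf.contDiffAt.toOpenPartialHomeomorph f hf' one_ne_zero
  have he : ∀ x, e x = f x := fun _ => rfl
  have h0e : (0 : CSpace n) ∈ e.source :=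
    hf.contDiffAt.mem_toOpenPartialHomeomorph_source hf' one_ne_zero
  have hsymm : ContDiffAt ℂ 1 e.symm (f 0) := hf.contDiffAt.to_localInverse hf' one_ne_zero
  obtain ⟨V, hV, hVo, h0V⟩ := eventually_nhds_iff.1 (hsymm.eventually (by simp))
  refine ⟨(e.symm.restrOpen V hVo).symm, ⟨⟨?_, ?_⟩, ?_, ?_, h, fun x _ => he x, ho⟩, he⟩
  · exact h0e
  · exact h0V
  · exact (hf.differentiable one_ne_zero).differentiableOn
  · exact fun y hy => ((hV y hy.2).differentiableAt one_ne_zero).differentiableWithinAt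

/-- In the new coordinates `M` is again a graph near the origin. -/
lemma isGraphNearZero_image {M : Set (CSpace n)} {F : (Fin n → ℂ) → ℂ} (hM : IsGraphNearZero M F)
    (hF : ContinuousAt F 0) (hF0 : F 0 = 0) {Φ : OpenPartialHomeomorph (CSpace n) (CSpace n)}
    {h : CSpace n → ℂ} (h0 : (0 : CSpace n) ∈ Φ.source) (hΦ : ∀ x, Φ x = (x.1, x.2 + h x))
    (hh0 : h 0 = 0) : IsGraphNearZero (Φ '' (M ∩ Φ.source)) fun z => F z + h (z, F z) := by
  have hΦ0 : Φ 0 = 0 := by rw [hΦ, hh0]; simp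
  have hΦs : Φ.symm 0 = 0 := by rw [← hΦ0, Φ.left_inv h0, hΦ0]
  have ht : (0 : CSpace n) ∈ Φ.target := by rw [← hΦ0]; exact Φ.map_source h0
  have hc : Tendsto Φ.symm (𝓝 0) (𝓝 0) := by
    have := (Φ.continuousAt_symm ht).tendsto
    rwa [hΦs] at this
  have hg : Tendsto (fun y : CSpace n => ((y.1, F y.1) : CSpace n)) (𝓝 0) (𝓝 0) := by
    have h1 : Tendsto (fun y : CSpace n => y.1) (𝓝 0) (𝓝 0) := continuous_fst.tendsto _
    have h2 : Tendsto F (𝓝 0) (𝓝 0) := by simpa [hF0] using hF.tendsto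
    exact h1.prodMk_nhds (h2.comp h1)
  filter_upwards [Φ.open_target.mem_nhds ht, hc.eventually hM,
    hg.eventually (Φ.open_source.mem_nhds h0)] with y hy h1 h2
  have hy1 : (Φ.symm y).1 = y.1 ∧ (Φ.symm y).2 + h (Φ.symm y) = y.2 := by
    have := (hΦ (Φ.symm y)).symm.trans (Φ.right_inv hy)
    have e1 := congrArg Prod.fst this
    have e2 := congrArg Prod.snd this
    exact ⟨e1, e2⟩
  have h3 : y ∈ Φ '' (M ∩ Φ.source) ↔ Φ.symm y ∈ M := by
    constructor
    · rintro ⟨x, ⟨hxM, hxs⟩, rfl⟩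
      rwa [Φ.left_inv hxs]
    · exact fun hM => ⟨_, ⟨hM, Φ.map_target hy⟩, Φ.right_inv hy⟩
  rw [h3, h1, hy1.1]
  constructor
  · intro h4
    rw [← hy1.2, ← h4, ← hy1.1]
  · intro h4
    have h5 : Φ (y.1, F y.1) = y := by rw [hΦ]; exact Prod.ext rfl h4.symm
    have h6 : Φ.symm y = (y.1, F y.1) := by rw [← h5, Φ.left_inv h2, h5]
    rw [h6]

lemma ev_quad_apply (lam : Fin n → ℝ) (z : Fin n → ℂ) :
    ev (quad lam) z = (bishopQuadric lam z : ℂ) := by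
  have h : ∀ w : ℂ, ((2 * (w ^ 2).re : ℝ) : ℂ) = w ^ 2 + starRingEnd ℂ w ^ 2 := by
    intro w
    rw [← map_pow, Complex.add_conj]
  rw [quad, bishopQuadric]
  simp only [map_sum, map_add, map_mul, map_pow, ev_X, ev_C, sum_apply, add_apply, mul_apply,
    pow_apply, algebraMap_apply, coord_inl, coord_inr, Complex.ofReal_sum]
  refine Finset.sum_congr rfl fun i _ => ?_
  rw [Complex.ofReal_add, Complex.ofReal_mul _ (2 * _), h, Complex.mul_conj, Complex.normSq_eq_norm_sq]

lemma exists_smoothFn_of_vanishesToOrder {p : (Fin n → ℂ) → ℝ} (hp : SmoothNearZero p) {k : ℕ}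
    (hk : VanishesToOrder k p) :
    ∃ P : SmoothFn n, VanishOrd k P ∧ ∀ᶠ z in 𝓝 0, P z = p z := by
  obtain ⟨U, hU, h0, hpU⟩ := hp
  obtain ⟨P, hP⟩ := exists_smoothFn_eventuallyEq (f := fun z => (p z : ℂ)) hU h0
    (Complex.ofRealCLM.contDiff.comp_contDiffOn hpU)
  refine ⟨P, VanishOrd.of_isBigO ?_, hP⟩
  exact hP.trans_isBigO (Complex.isBigO_ofReal_left.2 hk)

end Flattening

open Flattening Flattening.SmoothFn in
theorem corollary3p4 (n : ℕ) (hn : 2 ≤ n) (M : Set (CSpace n))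
    (hM : IsSmoothSubmanifold (2 * n) M)
    (lam : Fin n → ℝ) (hlam : ∀ i, 0 ≤ lam i)
    (p E : (Fin n → ℂ) → ℝ)
    (hp : SmoothNearZero p) (hE : SmoothNearZero E)
    (hp3 : VanishesToOrder 3 p) (hE3 : VanishesToOrder 3 E)
    (hgraph : IsGraphNearZero M
      (fun z => ((bishopQuadric lam z : ℝ) : ℂ) + (p z : ℂ) + Complex.I * (E z : ℂ)))
    (hnonparabolic : ∃ i, lam i ≠ 1 / 2)
    (hopen : ∃ U : Set (CSpace n), IsOpen U ∧
      {x | IsNonminimalCRPoint (2 * n) M x} = M ∩ U)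
    (hclosure : (0 : CSpace n) ∈ closure {x | IsNonminimalCRPoint (2 * n) M x})
    (N : ℕ) (hN : 0 < N) :
    ∃ (Φ : OpenPartialHomeomorph (CSpace n) (CSpace n)) (ρ : (Fin n → ℂ) → ℂ),
      IsSpecialTransform Φ ∧
      SmoothNearZero ρ ∧
      IsGraphNearZero (Φ '' (M ∩ Φ.source)) ρ ∧
      VanishesToOrder N (fun z => (ρ z).im) := by
  obtain ⟨a, ha⟩ := hnonparabolic
  have : Nontrivial (Fin n) := Fin.nontrivial_iff_two_le.2 hn
  obtain ⟨b, hb⟩ := exists_ne a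
  obtain ⟨p', hp'3, hp'⟩ := exists_smoothFn_of_vanishesToOrder hp hp3
  obtain ⟨E', hE'3, hE'⟩ := exists_smoothFn_of_vanishesToOrder hE hE3
  obtain ⟨F, hF⟩ : ∃ F : SmoothFn n, F = ev (quad lam) + p' + Complex.I • E' := ⟨_, rfl⟩
  have hF3 : VanishOrd 3 (F - ev (quad lam)) := by
    rw [hF, show ev (quad lam) + p' + Complex.I • E' - ev (quad lam) = p' + Complex.I • E' by ring]
    exact hp'3.add (hE'3.smul _)
  have hF0 : F 0 = 0 :=
    (Lead.vanishOrd (k := 2) ⟨quad_isHomogeneous lam, hF3⟩ : VanishOrd 2 F).1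
  have hMF : IsGraphNearZero M F := by
    have h1 : Tendsto (fun x : CSpace n => x.1) (𝓝 0) (𝓝 0) := continuous_fst.tendsto _
    filter_upwards [hgraph, h1.eventually hp', h1.eventually hE'] with x hx h2 h3
    rw [hx, hF, add_apply, add_apply, smul_apply, h2, h3, ev_quad_apply]
  obtain ⟨W, hWM, hW, h0W⟩ := eventually_nhds_iff.1 hMF
  obtain ⟨U, hU, hUM⟩ := hopen
  have hO : IsOpen {z | ((z, F z) : CSpace n) ∈ W ∩ U} :=
    (hW.inter hU).preimage (continuous_graph F)
  have h0O : (0 : Fin n → ℂ) ∈ closure {z | ((z, F z) : CSpace n) ∈ W ∩ U} := by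
    refine mem_closure_iff.2 fun V hV h0V => ?_
    obtain ⟨x, ⟨hxV, hxW⟩, hx⟩ := mem_closure_iff.1 hclosure (Prod.fst ⁻¹' V ∩ W)
      ((hV.preimage continuous_fst).inter hW) ⟨h0V, h0W⟩
    rw [hUM] at hx
    have h1 : x = (x.1, F x.1) := Prod.ext rfl ((hWM x hxW).1 hx.1)
    refine ⟨x.1, hxV, ?_⟩
    change (x.1, F x.1) ∈ W ∩ U
    rw [← h1]
    exact ⟨hxW, hx.2⟩
  obtain ⟨h, g, hg, hg3, hgN⟩ := exists_flattening_correction hn hlam hb.symm ha hF3 hO h0O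
    (fun z hz => hasStableFunctions_of_nonminimal hW hWM hz.1 (by
      have h1 : ((z, F z) : CSpace n) ∈ M ∩ U := ⟨(hWM _ hz.1).2 rfl, hz.2⟩
      rw [← hUM] at h1
      exact h1)) N
  obtain ⟨Φ, hΦ, hΦx⟩ := exists_isSpecialTransform hg.contDiff hg.isLittleO
  have hh0 : h 0 = 0 := by
    have h1 := hg.apply_graph 0
    rw [hF0, hg3.1] at h1
    exact h1.symm
  refine ⟨Φ, F + g, hΦ, ⟨Set.univ, isOpen_univ, trivial, (SmoothFn.contDiff (F + g)).contDiffOn⟩, ?_,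
    ?_⟩
  · have h1 := isGraphNearZero_image hMF (SmoothFn.continuous F).continuousAt hF0 hΦ.zero_mem hΦx hh0
    simpa only [IsGraphNearZero, Pi.add_apply, hg.apply_graph] using h1
  · have h1 := (hgN.mono (by omega : N ≤ N + 3)).isBigO
    refine IsBigO.trans (IsBigO.of_bound 1 (Eventually.of_forall fun z => ?_)) h1
    rw [sub_apply, conj_apply, Complex.sub_conj, norm_mul, Complex.norm_I, Complex.norm_real,
      Real.norm_eq_abs, Real.norm_eq_abs, abs_mul]
    have h2 := abs_nonneg ((F + g) z).im
    change |((F + g : SmoothFn n) z).im| ≤ _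
    rw [abs_two]
    linarith
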